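/- All graphs are finite, simple and undirected. For a graph $G=(V,E)$ with $n=|V|\ge 2$ and $m=|E|$ and for $S\subseteq V$ write $\bar S=V\setminus S$, $\mathrm{vol}(S)=\sum_{v\in S}\deg(v)$, let $E(S,\bar S)$ be the set of edges between $S$ and $\bar S$, and let $\phi(S)=|E(S,\bar S)|/\mathrm{vol}(S)$ (with $\phi(S)=0$ if $\mathrm{vol}(S)=0$). The conductance of $G$ is the minimum of $\phi(S)$ over all $\emptyset\ne S\subsetneq V$ with $\mathrm{vol}(S)\le\mathrm{vol}(\bar S)$. For a graph property $\mathcal P$, $G$ is $\epsilon$-far from $\mathcal P$ if every graph on the vertex set $V$ that has $\mathcal P$ differs from $G$ by at least $\epsilon m$ edge insertions and deletions. In the CONGEST model with constant $c\ge 1$, every vertex $v$ of $G$ is a processor that knows $n$, a unique integer identifier from $\{1,\dots,n^c\}$, and its degree; its channels to its neighbours are numbered $1,\dots,\deg(v)$ arbitrarily. All processors run the same algorithm, with independent private randomness and arbitrary local computation. In each synchronous round every processor sends to each neighbour a message of at most $c\log_2 n$ bits, receives its neighbours' messages, and updates its state; eventually it terminates with an output bit. The network accepts if all output bits are $1$ and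 rejects if some output bit is $0$. Theorem. For every $c\ge 1$ there is a constant $C>0$ such that for all $0<\Phi\le 1$ and $\epsilon>0$ there is a randomized distributed algorithm in the CONGEST model with constant $c$ such that on every graph $G=(V,E)$ with $|V|\ge 2$, with every port numbering and every assignment of unique identifiers from $\{1,\dots,|V|^c\}$: 1. all processors always terminate within $C\log(|V|+|E|)/(\epsilon\Phi^2)$ rounds; 2. if $G$ has conductance at least $\Phi$, then with probability at least $2/3$ all processors output $1$; 3. if $G$ is $\epsilon$-far from having conductance at least $\Phi^2/1000$, then with probability at least $2/3$ some processor outputs $0$. -/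

import Mathlib

open scoped Classical ENNReal

noncomputable section

namespace CongestTesting

/-! ### Graphs: volume, cuts, conductance, distance -/

section Graph

variable {V : Type*} [Fintype V]

/-- The volume of `S`: the sum of the degrees of its vertices. -/
def vol (G : SimpleGraph V) (S : Finset V) : ℕ := ∑ v ∈ S, G.degree v

/-- The number of edges between the disjoint sets `S` and `T`. -/
def cutSize (G : SimpleGraph V) (S T : Finset V) : ℕ := (G.interedges S T).card

/-- The conductance `|E(S, Sᶜ)| / vol S` of a set. A set of volume `0` (which consists of isolated
vertices, and which is not connected to its complement) has conductance `0`. -/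
def setConductance (G : SimpleGraph V) (S : Finset V) : ℝ :=
  (cutSize G S Sᶜ : ℝ) / (vol G S : ℝ)

/-- The conductance of a graph: the minimum of the conductance of `S` over all nonempty proper
vertex subsets `S` with `vol S ≤ vol Sᶜ`. (There are finitely many such sets, and at least one if
the graph has at least two vertices.) -/
def conductance (G : SimpleGraph V) : ℝ :=
  ⨅ S : {S : Finset V // S.Nonempty ∧ Sᶜ.Nonempty ∧ vol G S ≤ vol G Sᶜ}, setConductance G S.1

/-- The number of edges of a graph. -/
def numEdges (G : SimpleGraph V) : ℕ := G.edgeSet.ncard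

/-- The number of edges that have to be inserted or deleted to turn `G` into `H`. -/
def editDist (G H : SimpleGraph V) : ℕ := (symmDiff G.edgeSet H.edgeSet).ncard

/-- `G` is `ε`-far from the property `P`: at least `ε m` edges of `G` have to be modified
to obtain a graph with the property `P`. -/
def IsFar (ε : ℝ) (P : SimpleGraph V → Prop) (G : SimpleGraph V) : Prop :=
  ∀ H : SimpleGraph V, P H → ε * (numEdges G : ℝ) ≤ (editDist G H : ℝ)

end Graph

/-! ### Independent choices -/

section PiPMF

theorem tsum_prod_fin (n : ℕ) {S : Type*} (f : Fin n → S → ℝ≥0∞) :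
    ∑' σ : Fin n → S, ∏ i, f i (σ i) = ∏ i, ∑' s, f i s := by
  induction n with
  | zero => simp
  | succ n ih =>
    rw [← (Fin.consEquiv (fun _ : Fin (n + 1) => S)).tsum_eq, ENNReal.tsum_prod']
    simp only [Fin.consEquiv, Equiv.coe_fn_mk, Fin.prod_univ_succ, Fin.cons_zero, Fin.cons_succ]
    simp_rw [ENNReal.tsum_mul_left, ih, ENNReal.tsum_mul_right]

theorem tsum_prod_pi {V : Type*} [Fintype V] {S : Type*} (f : V → S → ℝ≥0∞) :
    ∑' σ : V → S, ∏ v, f v (σ v) = ∏ v, ∑' s, f v s := by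
  let e := Fintype.equivFin V
  rw [← (e.arrowCongr (Equiv.refl S)).symm.tsum_eq, ← e.symm.prod_comp, ← tsum_prod_fin]
  refine tsum_congr fun σ => ?_
  rw [← e.symm.prod_comp]
  simp

/-- The joint law of independent random elements, one for each `v`, with laws `p v`. -/
def piPMF {V : Type*} [Fintype V] {S : Type*} (p : V → PMF S) : PMF (V → S) :=
  ⟨fun σ => ∏ v, p v (σ v), by
    have h : ∑' σ : V → S, ∏ v, p v (σ v) = 1 := by
      rw [tsum_prod_pi (fun v s => p v s)]
      simp [PMF.tsum_coe]
    exact h ▸ ENNReal.summable.hasSum⟩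

end PiPMF

/-! ### Synchronous message passing -/

/-- A communication network with input as in the LOCAL and CONGEST models with constant `c`:
a graph, for every vertex `v` a numbering of the channels to its neighbours by `deg v` ports, and
unique numerical vertex identifiers from `{1, …, n ^ c}`. -/
structure Network (c : ℝ) (V : Type*) [Fintype V] where
  graph : SimpleGraph V
  port : ∀ v, Fin (graph.degree v) ≃ graph.neighborSet v
  id : V → ℕ
  id_injective : Function.Injective id
  id_pos : ∀ v, 1 ≤ id v
  id_le : ∀ v, (id v : ℝ) ≤ (Fintype.card V : ℝ) ^ c

/-- A randomized distributed algorithm; a copy of it runs at each vertex.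
* `init n i d` is the law of the state after the first local computation of a vertex with input
  `n` (number of vertices) and `i` (identifier) that has `d` ports;
* `send d s j` is the message that a vertex with `d` ports in state `s` sends through port `j`;
* `step d s msgs` is the law of the next state of a vertex with `d` ports that is in state `s` and
  has received the messages `msgs` (indexed by its ports);
* `output s` is `some b` if a vertex in state `s` has terminated with the output bit `b`, and `none`
  if it has not terminated yet. -/
structure DistAlgorithm where
  State : Type
  init : ℕ → ℕ → ℕ → PMF State
  send : (d : ℕ) → State → Fin d → List Bool
  step : (d : ℕ) → State → (Fin d → List Bool) → PMF State
  output : State → Option Bool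

section Run

variable {c : ℝ} {V : Type*} [Fintype V]

/-- The neighbour of `v` at its port `i`. -/
def Network.neighbor (N : Network c V) (v : V) (i : Fin (N.graph.degree v)) : V :=
  (N.port v i : V)

/-- The port through which the neighbour of `v` at port `i` communicates with `v`. -/
def Network.backPort (N : Network c V) (v : V) (i : Fin (N.graph.degree v)) :
    Fin (N.graph.degree (N.neighbor v i)) :=
  (N.port (N.neighbor v i)).symm ⟨v, ((N.port v i).2 : N.graph.Adj v _).symm⟩

namespace DistAlgorithm

/-- The message sent by `v` through its port `i` when the processors are in the states `σ`.
A processor that has terminated sends only empty messages. -/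
def message (A : DistAlgorithm) (N : Network c V) (σ : V → A.State) (v : V)
    (i : Fin (N.graph.degree v)) : List Bool :=
  if (A.output (σ v)).isSome then [] else A.send (N.graph.degree v) (σ v) i

/-- The messages received by `v`, indexed by the ports of `v`. -/
def received (A : DistAlgorithm) (N : Network c V) (σ : V → A.State) (v : V)
    (i : Fin (N.graph.degree v)) : List Bool :=
  A.message N σ (N.neighbor v i) (N.backPort v i)

/-- The law of the next state of `v`. A processor that has terminated keeps its state. -/
def nextState (A : DistAlgorithm) (N : Network c V) (σ : V → A.State) (v : V) : PMF A.State :=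
  if (A.output (σ v)).isSome then PMF.pure (σ v)
  else A.step (N.graph.degree v) (σ v) (A.received N σ v)

/-- The law of the states of all processors after `t` rounds of communication. All processors
use independent random choices. -/
def run (A : DistAlgorithm) (N : Network c V) : ℕ → PMF (V → A.State)
  | 0 => piPMF fun v => A.init (Fintype.card V) (N.id v) (N.graph.degree v)
  | t + 1 => (A.run N t).bind fun σ => piPMF fun v => A.nextState N σ v

/-- Every message that can be sent consists of at most `c log₂ n` bits. -/
def RespectsBandwidth (A : DistAlgorithm) (N : Network c V) : Prop :=
  ∀ t, ∀ σ ∈ (A.run N t).support, ∀ v i,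
    ((A.message N σ v i).length : ℝ) ≤ c * Real.logb 2 (Fintype.card V)

/-- Whatever the random choices are, every processor terminates within `t` rounds. -/
def HaltsWithin (A : DistAlgorithm) (N : Network c V) (t : ℕ) : Prop :=
  ∀ σ ∈ (A.run N t).support, ∀ v, (A.output (σ v)).isSome

/-- The probability that after `t` rounds all processors have terminated with output `1`. -/
def probAccept (A : DistAlgorithm) (N : Network c V) (t : ℕ) : ℝ≥0∞ :=
  (A.run N t).toOuterMeasure {σ | ∀ v, A.output (σ v) = some true}

/-- The probability that after `t` rounds some processor has terminated with output `0`. -/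
def probReject (A : DistAlgorithm) (N : Network c V) (t : ℕ) : ℝ≥0∞ :=
  (A.run N t).toOuterMeasure {σ | ∃ v, A.output (σ v) = some false}

/-- On the network `N`, the algorithm `A` obeys the CONGEST model, terminates within `t` rounds,
accepts with probability at least `2/3` if the graph has the property `P`, and rejects with
probability at least `2/3` if the graph is `ε`-far from the property `Q`. -/
structure TestsWithin (A : DistAlgorithm) (N : Network c V) (P Q : SimpleGraph V → Prop) (ε : ℝ)
    (t : ℕ) : Prop where
  bandwidth : A.RespectsBandwidth N
  halts : A.HaltsWithin N t
  complete : P N.graph → 2 / 3 ≤ A.probAccept N t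
  sound : IsFar ε Q N.graph → 2 / 3 ≤ A.probReject N t

end DistAlgorithm

end Run

end CongestTesting

end

open CongestTesting

/-!
The tester estimates the spectral gap of the lazy random walk `P` on the network by power
iteration. It does not depend on `ε` unless `ε > 3`: with `T = O(log n / Φ ^ 2)` steps, it separates
graphs of conductance at least `Φ` from *all* graphs of conductance less than `Φ ^ 2 / 1000`.

A function `f` on the vertices, with values of `O(log n)` bits, evolves by
`f v ↦ (f v + average of f over the neighbours of v) / 2`, rounded down. As this operator contracts
the supremum norm, the rounding errors only add up (`WeightedGraph.abs_sub_lazy_iterate_le`), so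
everything can be argued about the exact walk. The start function is
`(1 - n * [v is a leader]) / deg v + coin v - (average of coin over the neighbours of v)`,
where `coin v` is a random element of `{0, 1, 2}` and a leader is a vertex that has not heard of a
larger identifier than its own within `T` rounds. After `T` steps of the walk, a vertex accepts if
the value there is close to `0`.

*Conductance at least `Φ`.* By Cheeger's inequality (`WeightedGraph.sq_mul_inner_self_le_energy`),
`P ^ T` contracts functions of mean zero by a factor of `n ^ 49`. Hence the mass of every vertex reaches
every other vertex within `T` steps, so that there is exactly one leader
(`sum_leader_of_conductance`). Then the degree-weighted sum of the start function is zero, and the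
walk converges to `0` (`walkVerdict_of_conductance`).

*Conductance less than `Φ ^ 2 / 1000`.* If the graph is disconnected, then every component contains
a leader but fewer than `n` vertices; its total mass is negative and stays so
(`connected_of_walkVerdict`). If it is connected, let `g` be the centred indicator function of a
sparse cut. The moments `⟨g, P ^ t g⟩` are log-convex, so that `h = P ^ T g` has norm at least
about `(1 - Φ ^ 2 / 1000) ^ T`, which is at least `1 / n`
(`WeightedGraph.le_inner_lazy_iterate_centeredIndicator`). The inner product of `g` with the final
state is an affine function of the random numbers, whose coefficients are the values of
`deg v * (h v - average of h)`. Since the graph is connected and `h` has mean zero, some coefficient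
is not too small (`exists_abs_le_mul_abs_sub_avg`). So, whatever the other random numbers are, at
most one of the three values of this `coin v` leads to acceptance (`exists_eq_of_walkVerdict`).

Two reductions make the parameters fit. A connected graph has conductance at least `1 / n ^ 2`, so
that `Φ` may be replaced by `max Φ (1 / n ^ 2)`; this makes `T` polynomial in `n`, hence the rounding
errors are harmless. A graph without isolated vertices can be turned into a star, which has
conductance `1`, by at most `3 m` modifications, so that for `ε > 3` only isolated vertices have to be
detected (`le_three_of_isFar`). Finally, numbers of `O(log n)` bits are sent in
a constant number of messages of at most `log₂ n` bits each
(`BroadcastProtocol.simulation_run`).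
-/


noncomputable section

namespace CongestTesting

/-! ### Weighted graphs and the lazy random walk -/

/-- A finite graph with symmetric nonnegative edge weights in which every vertex has positive
degree. -/
structure WeightedGraph (V : Type*) [Fintype V] where
  w : V → V → ℝ
  symm : ∀ u v, w u v = w v u
  nonneg : ∀ u v, 0 ≤ w u v
  sum_pos : ∀ u, 0 < ∑ v, w u v

namespace WeightedGraph

variable {V : Type*} [Fintype V] (W : WeightedGraph V)

/-- The weighted degree. -/
def deg (u : V) : ℝ := ∑ v, W.w u v

/-- The inner product weighted by the degrees. -/
def inner (f g : V → ℝ) : ℝ := ∑ u, W.deg u * (f u * g u)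

/-- The average of `f` over the neighbours of a vertex. -/
def avg (f : V → ℝ) (u : V) : ℝ := (∑ v, W.w u v * f v) / W.deg u

/-- One step of the lazy random walk, acting on functions. -/
def lazy (f : V → ℝ) (u : V) : ℝ := (f u + W.avg f u) / 2

/-- The Dirichlet form; every edge is counted once, whence the factor `1 / 2`. -/
def energy (f : V → ℝ) : ℝ := (∑ u, ∑ v, W.w u v * (f u - f v) ^ 2) / 2

/-- The weighted volume of a set. -/
def volume (S : Finset V) : ℝ := ∑ u ∈ S, W.deg u

/-- The weight of the edges that leave a set. -/
def cut (S : Finset V) : ℝ := ∑ u ∈ S, ∑ v ∈ Sᶜ, W.w u v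

lemma deg_pos (u : V) : 0 < W.deg u := W.sum_pos u

lemma deg_mul_avg (f : V → ℝ) (u : V) : W.deg u * W.avg f u = ∑ v, W.w u v * f v := by
  unfold avg
  field_simp [(W.deg_pos u).ne']

lemma sum_sum_swap (F : V → V → ℝ) :
    ∑ u, ∑ v, W.w u v * F v u = ∑ u, ∑ v, W.w u v * F u v := by
  rw [Finset.sum_comm]
  simp_rw [W.symm]

lemma sum_sum_left (f : V → ℝ) : ∑ u, ∑ v, W.w u v * f u = ∑ u, W.deg u * f u := by
  simp_rw [← Finset.sum_mul]; rfl

lemma sum_sum_right (f : V → ℝ) : ∑ u, ∑ v, W.w u v * f v = ∑ u, W.deg u * f u := by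
  rw [W.sum_sum_swap (fun u _ => f u), W.sum_sum_left]

lemma inner_comm (f g : V → ℝ) : W.inner f g = W.inner g f := by
  unfold inner; simp_rw [mul_comm (f _)]

lemma inner_add_left (f f' g : V → ℝ) : W.inner (f + f') g = W.inner f g + W.inner f' g := by
  simp only [inner, Pi.add_apply, add_mul, mul_add, Finset.sum_add_distrib]

lemma inner_sub_left (f f' g : V → ℝ) : W.inner (f - f') g = W.inner f g - W.inner f' g := by
  simp only [inner, Pi.sub_apply, sub_mul, mul_sub, Finset.sum_sub_distrib]

lemma inner_smul_left (s : ℝ) (f g : V → ℝ) : W.inner (s • f) g = s * W.inner f g := by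
  simp only [inner, Pi.smul_apply, smul_eq_mul, Finset.mul_sum]
  exact Finset.sum_congr rfl fun _ _ => by ring

lemma inner_add_right (f g g' : V → ℝ) : W.inner f (g + g') = W.inner f g + W.inner f g' := by
  simp only [W.inner_comm f, inner_add_left]

lemma inner_sub_right (f g g' : V → ℝ) : W.inner f (g - g') = W.inner f g - W.inner f g' := by
  simp only [W.inner_comm f, inner_sub_left]

lemma inner_smul_right (s : ℝ) (f g : V → ℝ) : W.inner f (s • g) = s * W.inner f g := by
  simp only [W.inner_comm f, inner_smul_left]

lemma inner_self_nonneg (f : V → ℝ) : 0 ≤ W.inner f f :=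
  Finset.sum_nonneg fun u _ => mul_nonneg (W.deg_pos u).le (mul_self_nonneg _)

lemma deg_mul_sq_le_inner_self (f : V → ℝ) (u : V) : W.deg u * f u ^ 2 ≤ W.inner f f := by
  have := Finset.single_le_sum (f := fun u => W.deg u * (f u * f u))
    (fun u _ => mul_nonneg (W.deg_pos u).le (mul_self_nonneg _)) (Finset.mem_univ u)
  simpa [inner, sq] using this

lemma inner_avg_left (f g : V → ℝ) : W.inner (W.avg f) g = ∑ u, ∑ v, W.w u v * (g u * f v) := by
  refine Finset.sum_congr rfl fun u _ => ?_
  rw [← mul_assoc, W.deg_mul_avg, Finset.sum_mul]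
  exact Finset.sum_congr rfl fun v _ => by ring

lemma inner_avg_comm (f g : V → ℝ) : W.inner (W.avg f) g = W.inner f (W.avg g) := by
  rw [inner_avg_left, inner_comm, inner_avg_left, ← W.sum_sum_swap]
  simp_rw [mul_comm (g _)]

lemma lazy_eq (f : V → ℝ) : W.lazy f = (1 / 2 : ℝ) • (f + W.avg f) := by
  ext u; simp [lazy]; ring

lemma inner_lazy_comm (f g : V → ℝ) : W.inner (W.lazy f) g = W.inner f (W.lazy g) := by
  simp only [lazy_eq, inner_smul_left, inner_smul_right, inner_add_left, inner_add_right,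
    inner_avg_comm]

lemma inner_lazy_iterate_comm (t : ℕ) (f g : V → ℝ) :
    W.inner (W.lazy^[t] f) g = W.inner f (W.lazy^[t] g) := by
  induction t generalizing f g with
  | zero => rfl
  | succ t ih => rw [Function.iterate_succ_apply, ih, Function.iterate_succ_apply',
      inner_lazy_comm]

lemma inner_avg_self_eq (f : V → ℝ) : W.inner f (W.avg f) = W.inner f f - W.energy f := by
  rw [inner_comm, inner_avg_left, eq_sub_iff_add_eq, energy, ← eq_sub_iff_add_eq',
    div_eq_iff two_ne_zero]
  have h1 := W.sum_sum_left (fun u => f u * f u)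
  have h2 := W.sum_sum_right (fun u => f u * f u)
  simp only [inner]
  have : ∑ u, ∑ v, W.w u v * (f u - f v) ^ 2 = ∑ u, ∑ v, W.w u v * (f u * f u)
      + ∑ u, ∑ v, W.w u v * (f v * f v) - 2 * ∑ u, ∑ v, W.w u v * (f u * f v) := by
    simp only [Finset.mul_sum, ← Finset.sum_add_distrib, ← Finset.sum_sub_distrib]
    exact Finset.sum_congr rfl fun u _ => Finset.sum_congr rfl fun v _ => by ring
  rw [this, h1, h2]; ring

lemma energy_nonneg (f : V → ℝ) : 0 ≤ W.energy f :=
  div_nonneg (Finset.sum_nonneg fun u _ => Finset.sum_nonneg fun v _ =>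
    mul_nonneg (W.nonneg u v) (sq_nonneg _)) zero_le_two

/-- Averaging does not increase the norm (Jensen's inequality). -/
lemma inner_avg_avg_le (f : V → ℝ) : W.inner (W.avg f) (W.avg f) ≤ W.inner f f := by
  have h0 : 0 ≤ ∑ u, ∑ v, W.w u v * (f v - W.avg f u) ^ 2 :=
    Finset.sum_nonneg fun u _ => Finset.sum_nonneg fun v _ =>
      mul_nonneg (W.nonneg u v) (sq_nonneg _)
  have h1 := W.sum_sum_left (fun u => W.avg f u * W.avg f u)
  have h2 := W.sum_sum_right (fun u => f u * f u)
  have h3 := W.inner_avg_left f (W.avg f)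
  have : ∑ u, ∑ v, W.w u v * (f v - W.avg f u) ^ 2 = ∑ u, ∑ v, W.w u v * (f v * f v)
      + ∑ u, ∑ v, W.w u v * (W.avg f u * W.avg f u)
      - 2 * ∑ u, ∑ v, W.w u v * (W.avg f u * f v) := by
    simp only [Finset.mul_sum, ← Finset.sum_add_distrib, ← Finset.sum_sub_distrib]
    exact Finset.sum_congr rfl fun u _ => Finset.sum_congr rfl fun v _ => by ring
  rw [this, h1, h2, ← h3] at h0
  simp only [inner] at *
  linarith

lemma inner_lazy_self_eq (f : V → ℝ) : W.inner f (W.lazy f) = W.inner f f - W.energy f / 2 := by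
  rw [lazy_eq, inner_smul_right, inner_add_right, inner_avg_self_eq]; ring

/-- The lazy walk operator `P` satisfies `P² ≤ P`, because its spectrum lies in `[0, 1]`. -/
lemma inner_lazy_lazy_le (f : V → ℝ) : W.inner (W.lazy f) (W.lazy f) ≤ W.inner f (W.lazy f) := by
  have h := W.inner_avg_avg_le f
  have h' := W.inner_avg_comm f f
  simp only [lazy_eq, inner_smul_left, inner_smul_right, inner_add_left, inner_add_right]
  linarith

lemma avg_const (s : ℝ) : W.avg (fun _ => s) = fun _ => s := by
  ext u
  have := (W.deg_pos u).ne'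
  rw [avg, ← Finset.sum_mul, ← deg]
  field_simp

lemma lazy_const (s : ℝ) : W.lazy (fun _ => s) = fun _ => s := by
  ext u; rw [lazy, avg_const]; ring

lemma lazy_iterate_const (t : ℕ) (s : ℝ) : W.lazy^[t] (fun _ => s) = fun _ => s :=
  Function.iterate_fixed (W.lazy_const s) t

lemma avg_add (f g : V → ℝ) : W.avg (f + g) = W.avg f + W.avg g := by
  ext u; simp [avg, mul_add, Finset.sum_add_distrib, add_div]

lemma avg_smul (s : ℝ) (f : V → ℝ) : W.avg (s • f) = s • W.avg f := by
  ext u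
  simp only [avg, Pi.smul_apply, smul_eq_mul, mul_left_comm _ s, ← Finset.mul_sum, mul_div_assoc]

lemma lazy_sub (f g : V → ℝ) : W.lazy (f - g) = W.lazy f - W.lazy g := by
  rw [sub_eq_add_neg, ← neg_one_smul ℝ g, lazy_eq, lazy_eq, lazy_eq, avg_add, avg_smul]
  module

lemma lazy_iterate_sub (t : ℕ) (f g : V → ℝ) :
    W.lazy^[t] (f - g) = W.lazy^[t] f - W.lazy^[t] g := by
  induction t generalizing f g with
  | zero => rfl
  | succ t ih => simp only [Function.iterate_succ_apply, lazy_sub, ih]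

lemma abs_avg_le {f : V → ℝ} {s : ℝ} (h : ∀ u, |f u| ≤ s) (u : V) : |W.avg f u| ≤ s := by
  rw [avg, abs_div, abs_of_pos (W.deg_pos u), div_le_iff₀ (W.deg_pos u)]
  calc |∑ v, W.w u v * f v| ≤ ∑ v, |W.w u v * f v| := Finset.abs_sum_le_sum_abs _ _
    _ ≤ ∑ v, W.w u v * s := by
        refine Finset.sum_le_sum fun v _ => ?_
        rw [abs_mul, abs_of_nonneg (W.nonneg u v)]
        exact mul_le_mul_of_nonneg_left (h v) (W.nonneg u v)
    _ = s * W.deg u := by rw [← Finset.sum_mul, deg, mul_comm]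

lemma abs_lazy_le {f : V → ℝ} {s : ℝ} (h : ∀ u, |f u| ≤ s) (u : V) : |W.lazy f u| ≤ s := by
  have h1 := abs_le.1 (h u)
  have h2 := abs_le.1 (W.abs_avg_le h u)
  rw [lazy, abs_le]
  constructor <;> linarith

/-- If every step of the lazy walk is computed with an error of at most `1`, then after `t` steps
the accumulated error is at most `t` plus the error at the start. -/
lemma abs_sub_lazy_iterate_le {F : V → ℝ} {f : ℕ → V → ℝ} {s : ℝ} (h0 : ∀ u, |f 0 u - F u| ≤ s)
    (hf : ∀ t u, |f (t + 1) u - W.lazy (f t) u| ≤ 1) (t : ℕ) (u : V) :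
    |f t u - W.lazy^[t] F u| ≤ t + s := by
  induction t generalizing u with
  | zero => simpa using h0 u
  | succ t ih =>
    have h1 := W.abs_lazy_le (f := f t - W.lazy^[t] F) ih u
    rw [lazy_sub, ← Function.iterate_succ_apply' W.lazy] at h1
    have h2 := abs_add_le (f (t + 1) u - W.lazy (f t) u) ((W.lazy (f t) - W.lazy^[t + 1] F) u)
    have h3 := hf t u
    simp only [Pi.sub_apply, sub_add_sub_cancel] at h1 h2
    push_cast
    linarith

lemma inner_one_lazy_iterate (t : ℕ) (f : V → ℝ) :
    W.inner (fun _ => 1) (W.lazy^[t] f) = W.inner (fun _ => 1) f := by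
  rw [← inner_lazy_iterate_comm, lazy_iterate_const]

/-- Under a Poincaré inequality with constant `γ` the lazy walk contracts functions of mean zero. -/
lemma inner_lazy_iterate_self_le {γ : ℝ} (hγ : γ ≤ 2)
    (h : ∀ f, W.inner (fun _ => 1) f = 0 → γ * W.inner f f ≤ W.energy f)
    (t : ℕ) {f : V → ℝ} (hf : W.inner (fun _ => 1) f = 0) :
    W.inner (W.lazy^[t] f) (W.lazy^[t] f) ≤ (1 - γ / 2) ^ t * W.inner f f := by
  induction t with
  | zero => simp
  | succ t ih =>
    rw [Function.iterate_succ_apply', pow_succ']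
    have h1 := h (W.lazy^[t] f) (by rw [inner_one_lazy_iterate, hf])
    have h2 := W.inner_lazy_lazy_le (W.lazy^[t] f)
    rw [inner_lazy_self_eq] at h2
    have h3 := mul_le_mul_of_nonneg_left ih (show 0 ≤ 1 - γ / 2 by linarith)
    linarith

/-- A lower bound on the Rayleigh quotient persists under the lazy walk: the moments of `P` are
log-convex. -/
lemma mul_inner_self_le_lazy {ρ : ℝ} (hρ : 0 ≤ ρ) {f : V → ℝ}
    (h : ρ * W.inner f f ≤ W.inner f (W.lazy f)) :
    ρ ^ 2 * W.inner f f ≤ W.inner (W.lazy f) (W.lazy f) ∧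
      ρ * W.inner (W.lazy f) (W.lazy f) ≤ W.inner (W.lazy f) (W.lazy (W.lazy f)) := by
  -- Both `⟨k, k⟩` and `⟨k, P k⟩` are nonnegative for `k = P f - ρ f`.
  have h1 := W.inner_self_nonneg (W.lazy f - ρ • f)
  have h2 := (W.inner_self_nonneg _).trans (W.inner_lazy_lazy_le (W.lazy f - ρ • f))
  have h3 : W.lazy (ρ • f) = ρ • W.lazy f := by
    rw [lazy_eq, lazy_eq, avg_smul]; module
  have e1 : W.inner f (W.lazy (W.lazy f)) = W.inner (W.lazy f) (W.lazy f) :=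
    (W.inner_lazy_comm _ _).symm
  have e2 := W.inner_comm (W.lazy f) f
  rw [lazy_sub, h3] at h2
  simp only [inner_sub_left, inner_sub_right, inner_smul_left, inner_smul_right, e1, e2] at h1 h2
  have h4 := mul_le_mul_of_nonneg_left h hρ
  have h5 : ρ * W.inner f (W.lazy f) ≤ W.inner (W.lazy f) (W.lazy f) := by nlinarith
  have h6 := mul_le_mul_of_nonneg_left h5 hρ
  constructor <;> nlinarith

lemma pow_mul_inner_self_le_lazy_iterate {ρ : ℝ} (hρ : 0 ≤ ρ) {f : V → ℝ}
    (h : ρ * W.inner f f ≤ W.inner f (W.lazy f)) (t : ℕ) :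
    (ρ ^ t) ^ 2 * W.inner f f ≤ W.inner (W.lazy^[t] f) (W.lazy^[t] f) := by
  induction t generalizing f with
  | zero => simp
  | succ t ih =>
    obtain ⟨h1, h2⟩ := W.mul_inner_self_le_lazy hρ h
    rw [Function.iterate_succ_apply]
    refine le_trans ?_ (ih h2)
    have := mul_le_mul_of_nonneg_left h1 (sq_nonneg (ρ ^ t))
    calc (ρ ^ (t + 1)) ^ 2 * W.inner f f = (ρ ^ t) ^ 2 * (ρ ^ 2 * W.inner f f) := by ring
      _ ≤ _ := this

end WeightedGraph

namespace WeightedGraph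

variable {V : Type*} [Fintype V] (W : WeightedGraph V)

/-! ### Cheeger's inequality -/

lemma volume_add_volume_compl (S : Finset V) :
    W.volume S + W.volume Sᶜ = W.volume Finset.univ :=
  Finset.sum_add_sum_compl S _

lemma volume_mono {S T : Finset V} (h : S ⊆ T) : W.volume S ≤ W.volume T :=
  Finset.sum_le_sum_of_subset_of_nonneg h fun u _ _ => (W.deg_pos u).le

lemma volume_le_volume_compl_of_subset {S T : Finset V} (h : S ⊆ T)
    (hT : W.volume T ≤ W.volume Tᶜ) : W.volume S ≤ W.volume Sᶜ :=
  (W.volume_mono h).trans (hT.trans (W.volume_mono (Finset.compl_subset_compl.2 h)))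

lemma cut_eq_sum (S : Finset V) :
    W.cut S = ∑ u, ∑ v, W.w u v * (if u ∈ S ∧ v ∉ S then 1 else 0) := by
  simp [cut, Finset.sum_ite, ite_and, Finset.compl_eq_univ_sdiff, Finset.sdiff_eq_filter]

/-- The total variation of a function that arises from `g` by adding `s` on a set `S` outside of
which `g` vanishes. -/
lemma sum_abs_sub_add_indicator {g : V → ℝ} {S : Finset V} {s : ℝ} (hs : 0 ≤ s)
    (hg : ∀ u, 0 ≤ g u) (hS : ∀ u ∉ S, g u = 0) :
    ∑ u, ∑ v, W.w u v * |(g u + if u ∈ S then s else 0) - (g v + if v ∈ S then s else 0)|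
      = ∑ u, ∑ v, W.w u v * |g u - g v| + 2 * s * W.cut S := by
  have h1 := W.sum_sum_swap (fun u v => if u ∈ S ∧ v ∉ S then (1 : ℝ) else 0)
  have h2 := W.cut_eq_sum S
  have : ∑ u, ∑ v, W.w u v * |(g u + if u ∈ S then s else 0) - (g v + if v ∈ S then s else 0)|
      = ∑ u, ∑ v, W.w u v * |g u - g v|
        + s * (∑ u, ∑ v, W.w u v * (if u ∈ S ∧ v ∉ S then 1 else 0)
          + ∑ u, ∑ v, W.w u v * (if v ∈ S ∧ u ∉ S then 1 else 0)) := by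
    simp only [Finset.mul_sum, ← Finset.sum_add_distrib]
    refine Finset.sum_congr rfl fun u _ => Finset.sum_congr rfl fun v _ => ?_
    by_cases hu : u ∈ S <;> by_cases hv : v ∈ S <;> simp only [hu, hv, if_true, if_false, and_true,
      not_true, not_false_iff, and_false, mul_zero, add_zero, mul_one]
    · rw [add_sub_add_right_eq_sub]
    · rw [hS v hv, sub_zero, sub_zero, abs_of_nonneg (hg u),
        abs_of_nonneg (add_nonneg (hg u) hs)]; ring
    · rw [hS u hu, zero_sub, zero_sub, abs_neg, abs_neg, abs_of_nonneg (hg v),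
        abs_of_nonneg (add_nonneg (hg v) hs)]; ring
  rw [this, h1, ← h2]; ring

/-- The co-area inequality, by peeling off level sets. (The factor `2` is due to the sum over
ordered pairs, which counts every edge twice.) -/
lemma two_mul_le_sum_abs_sub {Φ : ℝ} (g : V → ℝ) (hg : ∀ u, 0 ≤ g u)
    (h : ∀ S : Finset V, (∀ u ∈ S, g u ≠ 0) → Φ * W.volume S ≤ W.cut S) :
    2 * Φ * ∑ u, W.deg u * g u ≤ ∑ u, ∑ v, W.w u v * |g u - g v| := by
  induction hn : (Finset.univ.filter fun u => g u ≠ 0).card using Nat.strong_induction_on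
    generalizing g with
  | _ n ih =>
    set S := Finset.univ.filter fun u => g u ≠ 0 with hS
    have hmem : ∀ u, u ∈ S ↔ g u ≠ 0 := by simp [hS]
    rcases S.eq_empty_or_nonempty with h0 | hne
    · have h0' : ∀ u, g u = 0 := fun u => by
        by_contra hu; simpa [h0] using (hmem u).2 hu
      simp [h0']
    · obtain ⟨x, hx, hmin⟩ := Finset.exists_min_image S g hne
      have hgx : 0 ≤ g x := hg x
      set g' : V → ℝ := fun u => g u - if u ∈ S then g x else 0 with hg'
      have hg'0 : ∀ u, 0 ≤ g' u := fun u => by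
        by_cases hu : u ∈ S
        · simp [hg', hu, hmin u hu]
        · simp [hg', hu, hg u]
      have hsub : ∀ u, g' u ≠ 0 → g u ≠ 0 := fun u hu h0 => hu (by
        have : u ∉ S := fun h => (hmem u).1 h h0
        simp [hg', this, h0])
      have hlt : (Finset.univ.filter fun u => g' u ≠ 0).card < n := by
        rw [← hn]
        apply Finset.card_lt_card
        refine Finset.ssubset_iff_subset_ne.2 ⟨fun u => by simpa [hS] using hsub u, fun he => ?_⟩
        rw [← he] at hx
        have : g' x ≠ 0 := by simpa using hx
        rw [he] at hx
        exact this (by simp [hg', hx])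
      have key := ih _ hlt g' hg'0 (fun T hT => h T fun u hu => hsub u (hT u hu)) rfl
      have hS0 : ∀ u ∉ S, g' u = 0 := fun u hu => by
        by_contra h'; exact hu ((hmem u).2 (hsub u h'))
      have e := W.sum_abs_sub_add_indicator hgx hg'0 hS0
      have hcut := mul_le_mul_of_nonneg_left (h S fun u hu => (hmem u).1 hu) hgx
      have hvol : ∑ u, W.deg u * g u = ∑ u, W.deg u * g' u + g x * W.volume S := by
        have : g x * W.volume S = ∑ u, W.deg u * (if u ∈ S then g x else 0) := by
          simp [volume, Finset.mul_sum, Finset.sum_ite_mem, mul_comm]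
        rw [this, ← Finset.sum_add_distrib]
        exact Finset.sum_congr rfl fun u _ => by simp only [hg']; ring
      simp only [hg', sub_add_cancel] at e
      rw [e, hvol]
      simp only [hg'] at key ⊢
      linarith

/-- Cheeger's inequality for a nonnegative function whose support is expanding. -/
lemma sq_mul_inner_self_le_energy_of_nonneg {Φ : ℝ} (hΦ : 0 < Φ) (g : V → ℝ) (hg : ∀ u, 0 ≤ g u)
    (h : ∀ S : Finset V, (∀ u ∈ S, g u ≠ 0) → Φ * W.volume S ≤ W.cut S) :
    Φ ^ 2 / 2 * W.inner g g ≤ W.energy g := by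
  have h1 := W.two_mul_le_sum_abs_sub (fun u => g u * g u) (fun u => mul_self_nonneg _)
    (fun S hS => h S fun u hu => by simpa using hS u hu)
  -- Weighted AM-GM applied to `|g u ^ 2 - g v ^ 2| = |g u - g v| * (g u + g v)`.
  have h2 : ∑ u, ∑ v, W.w u v * |g u * g u - g v * g v| ≤
      Φ⁻¹ * ∑ u, ∑ v, W.w u v * (g u - g v) ^ 2 +
        Φ / 2 * (∑ u, ∑ v, W.w u v * (g u * g u) + ∑ u, ∑ v, W.w u v * (g v * g v)) := by
    simp only [Finset.mul_sum, ← Finset.sum_add_distrib]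
    refine Finset.sum_le_sum fun u _ => Finset.sum_le_sum fun v _ => ?_
    have h3 : |g u * g u - g v * g v| ≤
        Φ⁻¹ * (g u - g v) ^ 2 + Φ / 2 * (g u * g u + g v * g v) := by
      have e : g u * g u - g v * g v = (g u - g v) * (g u + g v) := by ring
      rw [e, abs_mul, abs_of_nonneg (add_nonneg (hg u) (hg v)), ← sq_abs (g u - g v)]
      have a1 := mul_nonneg (inv_pos.2 hΦ).le (sq_nonneg (|g u - g v| - Φ / 2 * (g u + g v)))
      have a2 := mul_nonneg hΦ.le (sq_nonneg (g u - g v))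
      have e2 : Φ⁻¹ * (|g u - g v| - Φ / 2 * (g u + g v)) ^ 2 = Φ⁻¹ * |g u - g v| ^ 2
          - |g u - g v| * (g u + g v) + Φ / 4 * (g u + g v) ^ 2 := by
        field_simp; ring
      nlinarith
    have := mul_le_mul_of_nonneg_left h3 (W.nonneg u v)
    linarith
  rw [W.sum_sum_left (fun u => g u * g u), W.sum_sum_right (fun u => g u * g u)] at h2
  have h4 : Φ * W.inner g g ≤ Φ⁻¹ * (2 * W.energy g) := by
    have : 2 * W.energy g = ∑ u, ∑ v, W.w u v * (g u - g v) ^ 2 := by rw [energy]; ring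
    rw [this]
    simp only [inner] at *
    linarith
  have h5 := mul_le_mul_of_nonneg_left h4 hΦ.le
  rw [← mul_assoc Φ Φ⁻¹, mul_inv_cancel₀ hΦ.ne'] at h5
  linarith

/-- A median with respect to the degrees: neither strict level set has more than half of the
volume. -/
lemma exists_median [Nonempty V] (f : V → ℝ) : ∃ s : ℝ,
    W.volume (Finset.univ.filter fun u => s < f u) ≤
        W.volume (Finset.univ.filter fun u => s < f u)ᶜ ∧
      W.volume (Finset.univ.filter fun u => f u < s) ≤
        W.volume (Finset.univ.filter fun u => f u < s)ᶜ := by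
  set C := Finset.univ.filter fun x => W.volume (Finset.univ.filter fun u => f x < f u) ≤
        W.volume (Finset.univ.filter fun u => f x < f u)ᶜ with hC
  have hne : C.Nonempty := by
    obtain ⟨x, -, hx⟩ := Finset.exists_max_image Finset.univ f Finset.univ_nonempty
    refine ⟨x, ?_⟩
    have : (Finset.univ.filter fun u => f x < f u) = ∅ := by
      ext u; simpa using hx u (Finset.mem_univ u)
    simp only [hC, Finset.mem_filter, Finset.mem_univ, true_and, this]
    exact W.volume_mono (Finset.empty_subset _)
  obtain ⟨x, hx, hmin⟩ := Finset.exists_min_image C f hne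
  refine ⟨f x, by simpa [hC] using hx, ?_⟩
  set L := Finset.univ.filter fun u => f u < f x with hL
  rcases L.eq_empty_or_nonempty with h0 | hLne
  · rw [h0]; exact W.volume_mono (Finset.empty_subset _)
  · obtain ⟨y, hy, hmax⟩ := Finset.exists_max_image L f hLne
    have hyx : f y < f x := by simpa [hL] using hy
    have e : (Finset.univ.filter fun u => f y < f u) = Lᶜ := by
      ext u
      simp only [hL, Finset.mem_filter, Finset.mem_univ, true_and, Finset.mem_compl, not_lt]
      refine ⟨fun hu => ?_, fun hu => hyx.trans_le hu⟩
      by_contra! hlt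
      exact absurd (hmax u (by simpa [hL] using hlt)) (not_le.2 hu)
    have hyC : y ∉ C := fun h => absurd (hmin y h) (not_le.2 hyx)
    simp only [hC, Finset.mem_filter, Finset.mem_univ, true_and, e, compl_compl, not_le] at hyC
    exact hyC.le

/-- **Cheeger's inequality**: a graph of conductance at least `Φ` satisfies a Poincaré inequality
with constant `Φ ^ 2 / 2`. -/
theorem sq_mul_inner_self_le_energy {Φ : ℝ} (hΦ : 0 < Φ)
    (h : ∀ S : Finset V, W.volume S ≤ W.volume Sᶜ → Φ * W.volume S ≤ W.cut S)
    (f : V → ℝ) (hf : W.inner (fun _ => 1) f = 0) :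
    Φ ^ 2 / 2 * W.inner f f ≤ W.energy f := by
  rcases isEmpty_or_nonempty V with hV | hV
  · simp [inner, energy]
  obtain ⟨s, h1, h2⟩ := W.exists_median f
  have hp := W.sq_mul_inner_self_le_energy_of_nonneg hΦ (fun u => max (f u - s) 0)
    (fun u => le_max_right _ _) (fun S hS => h S <|
      W.volume_le_volume_compl_of_subset (fun u hu => by simpa using hS u hu) h1)
  have hm := W.sq_mul_inner_self_le_energy_of_nonneg hΦ (fun u => max (s - f u) 0)
    (fun u => le_max_right _ _) (fun S hS => h S <|
      W.volume_le_volume_compl_of_subset (fun u hu => by simpa using hS u hu) h2)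
  have hE : W.energy (fun u => max (f u - s) 0) + W.energy (fun u => max (s - f u) 0)
      ≤ W.energy f := by
    simp only [energy, ← add_div, ← Finset.sum_add_distrib]
    refine div_le_div_of_nonneg_right ?_ zero_le_two
    refine Finset.sum_le_sum fun u _ => Finset.sum_le_sum fun v _ => ?_
    rw [← mul_add]
    refine mul_le_mul_of_nonneg_left ?_ (W.nonneg u v)
    rcases le_total (f u) s with hu | hu <;> rcases le_total (f v) s with hv | hv
    · rw [max_eq_right (by linarith), max_eq_right (by linarith), max_eq_left (by linarith),
        max_eq_left (by linarith)]; nlinarith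
    · rw [max_eq_right (by linarith), max_eq_left (by linarith), max_eq_left (by linarith),
        max_eq_right (by linarith)]; nlinarith
    · rw [max_eq_left (by linarith), max_eq_right (by linarith), max_eq_right (by linarith),
        max_eq_left (by linarith)]; nlinarith
    · rw [max_eq_left (by linarith), max_eq_left (by linarith), max_eq_right (by linarith),
        max_eq_right (by linarith)]; nlinarith
  -- As `f` has mean zero, subtracting the median `s` does not decrease its norm.
  have hI : W.inner f f ≤ W.inner (fun u => max (f u - s) 0) (fun u => max (f u - s) 0)
      + W.inner (fun u => max (s - f u) 0) (fun u => max (s - f u) 0) := by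
    have e : W.inner (fun u => max (f u - s) 0) (fun u => max (f u - s) 0)
      + W.inner (fun u => max (s - f u) 0) (fun u => max (s - f u) 0) =
        W.inner f f - 2 * s * W.inner (fun _ => 1) f
          + s ^ 2 * W.inner (fun _ => 1) (fun _ => 1) := by
      simp only [inner, Finset.mul_sum, ← Finset.sum_add_distrib, ← Finset.sum_sub_distrib]
      refine Finset.sum_congr rfl fun u _ => ?_
      rcases le_total (f u) s with hu | hu
      · rw [max_eq_right (by linarith), max_eq_left (by linarith)]; ring
      · rw [max_eq_left (by linarith), max_eq_right (by linarith)]; ring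
    have := mul_nonneg (sq_nonneg s) (W.inner_self_nonneg (fun _ => 1))
    rw [e, hf]; linarith
  have := mul_le_mul_of_nonneg_left hI (by positivity : 0 ≤ Φ ^ 2 / 2)
  linarith

end WeightedGraph

namespace WeightedGraph

variable {V : Type*} [Fintype V] (W : WeightedGraph V)

/-! ### The lazy walk in the presence of a sparse cut -/

/-- The indicator function of `S`, shifted to have mean zero. -/
def centeredIndicator (S : Finset V) (u : V) : ℝ :=
  (if u ∈ S then 1 else 0) - W.volume S / W.volume Finset.univ

lemma volume_nonneg (S : Finset V) : 0 ≤ W.volume S :=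
  Finset.sum_nonneg fun u _ => (W.deg_pos u).le

lemma inner_one_indicator (S : Finset V) :
    W.inner (fun _ => 1) (fun u => if u ∈ S then 1 else 0) = W.volume S := by
  simp [inner, volume, Finset.sum_ite_mem]

lemma inner_one_one : W.inner (fun _ => 1) (fun _ => 1) = W.volume Finset.univ := by
  simp [inner, volume]

lemma energy_centeredIndicator (S : Finset V) : W.energy (W.centeredIndicator S) = W.cut S := by
  have h1 := W.sum_sum_swap (fun u v => if u ∈ S ∧ v ∉ S then (1 : ℝ) else 0)
  have h2 := W.cut_eq_sum S
  have h3 : ∑ u, ∑ v, W.w u v * (W.centeredIndicator S u - W.centeredIndicator S v) ^ 2 =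
      ∑ u, ∑ v, W.w u v * (if u ∈ S ∧ v ∉ S then 1 else 0)
        + ∑ u, ∑ v, W.w u v * (if v ∈ S ∧ u ∉ S then 1 else 0) := by
    simp only [← Finset.sum_add_distrib]
    refine Finset.sum_congr rfl fun u _ => Finset.sum_congr rfl fun v _ => ?_
    simp only [centeredIndicator, sub_sub_sub_cancel_right]
    by_cases hu : u ∈ S <;> by_cases hv : v ∈ S <;> simp [hu, hv]
  rw [energy, h3, h1, ← h2]; ring

lemma inner_one_centeredIndicator {S : Finset V} (hS : 0 < W.volume S) :
    W.inner (fun _ => 1) (W.centeredIndicator S) = 0 := by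
  have hpos := hS.trans_le (W.volume_mono (Finset.subset_univ S))
  have e : W.centeredIndicator S = (fun u => if u ∈ S then 1 else 0)
      - (W.volume S / W.volume Finset.univ) • (fun _ => (1 : ℝ)) := by
    ext u; simp [centeredIndicator]
  rw [e, inner_sub_right, inner_smul_right, inner_one_indicator, inner_one_one]
  field_simp; ring

lemma volume_div_two_le_inner_centeredIndicator {S : Finset V} (hS : 0 < W.volume S)
    (h : W.volume S ≤ W.volume Sᶜ) :
    W.volume S / 2 ≤ W.inner (W.centeredIndicator S) (W.centeredIndicator S) := by
  have hpos := hS.trans_le (W.volume_mono (Finset.subset_univ S))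
  have hadd := W.volume_add_volume_compl S
  set s := W.volume S / W.volume Finset.univ with hs
  have hs2 : s ≤ 1 / 2 := by rw [hs, div_le_iff₀ hpos]; linarith
  have e : W.centeredIndicator S = (fun u => if u ∈ S then 1 else 0) - s • (fun _ => (1 : ℝ)) := by
    ext u; simp [centeredIndicator, hs]
  have h1 := W.inner_one_centeredIndicator hS
  have h2 : W.inner (fun u => if u ∈ S then 1 else 0) (W.centeredIndicator S) =
      (1 - s) * W.volume S := by
    simp only [inner, centeredIndicator, ← hs]
    rw [volume, Finset.mul_sum]
    rw [← Finset.sum_subset (Finset.subset_univ S)]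
    · exact Finset.sum_congr rfl fun u hu => by simp [hu]; ring
    · intro u _ hu; simp [hu]
  have h3 : W.inner (W.centeredIndicator S) (W.centeredIndicator S) = (1 - s) * W.volume S := by
    nth_rewrite 1 [e]
    rw [inner_sub_left, inner_smul_left, h1, h2]; ring
  rw [h3]; nlinarith

lemma abs_centeredIndicator_le (S : Finset V) (u : V) : |W.centeredIndicator S u| ≤ 1 := by
  have h0 : 0 ≤ W.volume S / W.volume Finset.univ :=
    div_nonneg (W.volume_nonneg _) (W.volume_nonneg _)
  have h1 : W.volume S / W.volume Finset.univ ≤ 1 :=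
    div_le_one_of_le₀ (W.volume_mono (Finset.subset_univ S)) (W.volume_nonneg _)
  rw [centeredIndicator, abs_le]
  split_ifs <;> constructor <;> linarith

/-- The part of the lazy walk that distinguishes a sparse cut decays slowly. -/
lemma le_inner_lazy_iterate_centeredIndicator {S : Finset V} {δ : ℝ} (hδ1 : δ ≤ 1)
    (hS : 1 ≤ W.volume S) (h : W.volume S ≤ W.volume Sᶜ) (hcut : W.cut S ≤ δ * W.volume S)
    (t : ℕ) :
    ((1 - δ) ^ t) ^ 2 / 2 ≤ W.inner (W.lazy^[t] (W.centeredIndicator S))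
      (W.lazy^[t] (W.centeredIndicator S)) := by
  have h1 := W.volume_div_two_le_inner_centeredIndicator (by linarith) h
  have hδ : 0 ≤ δ := by
    have : 0 ≤ W.cut S := W.energy_centeredIndicator S ▸ W.energy_nonneg _
    by_contra! hneg
    nlinarith
  have h2 := W.pow_mul_inner_self_le_lazy_iterate (ρ := 1 - δ) (by linarith)
    (f := W.centeredIndicator S) (by
      rw [inner_lazy_self_eq, energy_centeredIndicator]
      nlinarith) t
  refine le_trans ?_ h2
  have : (1 : ℝ) / 2 ≤ W.inner (W.centeredIndicator S) (W.centeredIndicator S) := by linarith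
  have := mul_le_mul_of_nonneg_left this (sq_nonneg ((1 - δ) ^ t))
  linarith

end WeightedGraph

/-! ### Conductance -/

section Conductance

variable {V : Type*} [Fintype V]

/-- A graph without isolated vertices as a weighted graph, all edges having weight `1`. -/
def WeightedGraph.ofGraph (G : SimpleGraph V) (hd : ∀ v, 0 < G.degree v) : WeightedGraph V where
  w u v := if G.Adj u v then 1 else 0
  symm u v := by simp only [G.adj_comm]
  nonneg u v := by split_ifs <;> norm_num
  sum_pos u := by
    have := hd u
    rw [← SimpleGraph.card_neighborFinset_eq_degree, SimpleGraph.neighborFinset_eq_filter] at this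
    simpa using this

section OfGraph

variable (G : SimpleGraph V) (hd : ∀ v, 0 < G.degree v)

lemma WeightedGraph.ofGraph_w (u v : V) :
    (WeightedGraph.ofGraph G hd).w u v = if G.Adj u v then 1 else 0 := rfl

lemma WeightedGraph.ofGraph_deg (u : V) : (WeightedGraph.ofGraph G hd).deg u = G.degree u := by
  rw [← SimpleGraph.card_neighborFinset_eq_degree, SimpleGraph.neighborFinset_eq_filter]
  simp [WeightedGraph.deg, WeightedGraph.ofGraph_w]

lemma WeightedGraph.ofGraph_volume (S : Finset V) :
    (WeightedGraph.ofGraph G hd).volume S = vol G S := by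
  simp [WeightedGraph.volume, vol, WeightedGraph.ofGraph_deg]

lemma WeightedGraph.ofGraph_cut (S : Finset V) :
    (WeightedGraph.ofGraph G hd).cut S = cutSize G S Sᶜ := by
  rw [cutSize, SimpleGraph.interedges_def, Finset.card_filter, Finset.sum_product]
  simp [WeightedGraph.cut, WeightedGraph.ofGraph_w]

end OfGraph

lemma vol_le_sq (G : SimpleGraph V) (S : Finset V) : vol G S ≤ Fintype.card V ^ 2 := by
  calc vol G S ≤ ∑ v ∈ S, Fintype.card V :=
        Finset.sum_le_sum fun v _ => (G.degree_lt_card_verts v).le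
    _ ≤ ∑ v : V, Fintype.card V :=
        Finset.sum_le_sum_of_subset (Finset.subset_univ S)
    _ = _ := by simp [sq]

lemma conductance_le (G : SimpleGraph V) {S : Finset V} (h1 : S.Nonempty) (h2 : Sᶜ.Nonempty)
    (h3 : vol G S ≤ vol G Sᶜ) : conductance G ≤ setConductance G S :=
  ciInf_le (f := fun S : {S : Finset V // S.Nonempty ∧ Sᶜ.Nonempty ∧ vol G S ≤ vol G Sᶜ} =>
    setConductance G S.1) (Set.finite_range _).bddBelow ⟨S, h1, h2, h3⟩

lemma degree_pos_of_conductance_pos {G : SimpleGraph V} (hn : 2 ≤ Fintype.card V)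
    (h : 0 < conductance G) (v : V) : 0 < G.degree v := by
  by_contra! h0
  have hv : vol G {v} = 0 := by simpa [vol] using h0
  have hc : ({v} : Finset V)ᶜ.Nonempty := by
    rw [← Finset.card_pos, Finset.card_compl, Finset.card_singleton]; omega
  have := conductance_le G (Finset.singleton_nonempty v) hc (by omega)
  rw [setConductance, hv] at this
  simp at this
  linarith

/-- A graph of positive conductance is connected, so that every cut has at least one edge. -/
lemma mul_vol_le_cutSize {G : SimpleGraph V} {Φ : ℝ} (hn : 2 ≤ Fintype.card V) (hΦ : 0 < Φ)
    (h : Φ ≤ conductance G) (S : Finset V) (hS : vol G S ≤ vol G Sᶜ) :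
    max Φ (1 / (Fintype.card V : ℝ) ^ 2) * vol G S ≤ cutSize G S Sᶜ := by
  rcases Nat.eq_zero_or_pos (vol G S) with h0 | hpos
  · simp [h0]
  have h1 : S.Nonempty := by
    rw [Finset.nonempty_iff_ne_empty]; rintro rfl; simp [vol] at hpos
  have h2 : Sᶜ.Nonempty := by
    rw [Finset.nonempty_iff_ne_empty]
    intro he
    rw [he, show vol G ∅ = 0 from Finset.sum_empty] at hS
    omega
  have hpos' : (0 : ℝ) < vol G S := by exact_mod_cast hpos
  have h3 := h.trans (conductance_le G h1 h2 hS)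
  rw [setConductance, le_div_iff₀ hpos'] at h3
  have h4 : (0 : ℝ) < cutSize G S Sᶜ := lt_of_lt_of_le (by positivity) h3
  have h5 : (1 : ℝ) ≤ cutSize G S Sᶜ := by exact_mod_cast h4
  rcases max_choice Φ (1 / (Fintype.card V : ℝ) ^ 2) with e | e <;> rw [e]
  · exact h3
  · refine le_trans ?_ h5
    rw [one_div, inv_mul_le_iff₀ (by positivity), mul_one]
    exact_mod_cast vol_le_sq G S

lemma exists_sparse_cut {G : SimpleGraph V} (hn : 2 ≤ Fintype.card V)
    (hd : ∀ v, 0 < G.degree v) {δ : ℝ} (h : conductance G < δ) :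
    ∃ S : Finset V, 1 ≤ vol G S ∧ vol G S ≤ vol G Sᶜ ∧
      (cutSize G S Sᶜ : ℝ) ≤ δ * vol G S := by
  obtain ⟨v⟩ : Nonempty V := Fintype.card_pos_iff.1 (by omega)
  have hc : ({v} : Finset V)ᶜ.Nonempty := by
    rw [← Finset.card_pos, Finset.card_compl, Finset.card_singleton]; omega
  have hne : Nonempty {S : Finset V // S.Nonempty ∧ Sᶜ.Nonempty ∧ vol G S ≤ vol G Sᶜ} := by
    rcases le_total (vol G {v}) (vol G {v}ᶜ) with hle | hle
    · exact ⟨{v}, Finset.singleton_nonempty v, hc, hle⟩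
    · exact ⟨{v}ᶜ, hc, by simp, by simpa using hle⟩
  obtain ⟨⟨S, h1, h2, h3⟩, hS⟩ := exists_lt_of_ciInf_lt h
  have hpos : 0 < vol G S := Finset.sum_pos (fun v _ => hd v) h1
  refine ⟨S, hpos, h3, ?_⟩
  have hpos' : (0 : ℝ) < vol G S := by exact_mod_cast hpos
  exact ((div_lt_iff₀ hpos').1 hS).le

/-! ### The trivial range of the distance parameter -/

/-- The star with centre `x`. (A definition rather than a notation: degrees and cuts are counted
with the classical decidability of adjacency, not with the one that Mathlib provides for stars.) -/
def star {V : Type*} (x : V) : SimpleGraph V := SimpleGraph.starGraph x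

lemma star_adj {V : Type*} {x u v : V} : (star x).Adj u v ↔ u ≠ v ∧ (u = x ∨ v = x) :=
  SimpleGraph.starGraph_adj

lemma degree_star_of_ne {x u : V} (h : u ≠ x) : (star x).degree u = 1 := by
  rw [← SimpleGraph.card_neighborFinset_eq_degree, Finset.card_eq_one]
  refine ⟨x, ?_⟩
  ext v
  simp only [SimpleGraph.mem_neighborFinset, star_adj, Finset.mem_singleton]
  constructor
  · rintro ⟨-, h' | h'⟩
    · exact absurd h' h
    · exact h'
  · rintro rfl; exact ⟨h, Or.inr rfl⟩

lemma degree_star_self (x : V) : (star x).degree x = Fintype.card V - 1 := by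
  rw [← SimpleGraph.card_neighborFinset_eq_degree, ← Finset.card_univ,
    ← Finset.card_erase_of_mem (Finset.mem_univ x)]
  congr 1
  ext v
  simp [star_adj, eq_comm]

/-- In the star, every edge that has an endpoint in `S` leaves `S`, if `S` has at most half of the
volume. -/
lemma vol_star_le_cutSize (x : V) (S : Finset V) (h : vol (star x) S ≤ vol (star x) Sᶜ) :
    vol (star x) S ≤ cutSize (star x) S Sᶜ := by
  have key : ∀ T : Finset V, x ∉ T → vol (star x) T = T.card := fun T hT => by
    rw [vol, Finset.card_eq_sum_ones]
    exact Finset.sum_congr rfl fun u hu => degree_star_of_ne fun e => hT (e ▸ hu)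
  by_cases hx : x ∈ S
  · have h1 : vol (star x) S = (Fintype.card V - 1) + (S.card - 1) := by
      rw [vol, ← Finset.add_sum_erase S _ hx, degree_star_self, ← Finset.card_erase_of_mem hx]
      congr 1
      exact key _ (Finset.notMem_erase x S)
    have h2 : vol (star x) Sᶜ = Fintype.card V - S.card := by
      rw [key _ (by simpa using hx), Finset.card_compl]
    have h3 : 0 < S.card := Finset.card_pos.2 ⟨x, hx⟩
    have h4 : S.card ≤ Fintype.card V := Finset.card_le_univ S
    have h5 : vol (star x) S = Sᶜ.card := by rw [Finset.card_compl]; omega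
    rw [h5, cutSize]
    refine Finset.card_le_card_of_injOn (fun v => (x, v)) (fun v hv => ?_) (fun u _ v _ e => by
      simpa using e)
    have hv' : v ∉ S := by simpa using hv
    simp only [Finset.mem_coe, SimpleGraph.mem_interedges_iff, star_adj]
    exact ⟨hx, by simpa using hv', fun e => hv' (e ▸ hx), by simp⟩
  · rw [key S hx, cutSize]
    refine Finset.card_le_card_of_injOn (fun v => (v, x)) (fun v hv => ?_) (fun u _ v _ e => by
      simpa using e)
    simp only [Finset.mem_coe, SimpleGraph.mem_interedges_iff, star_adj]
    exact ⟨hv, by simpa using hx, fun e => hx (e ▸ hv), by simp⟩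

lemma one_le_conductance_star (hn : 2 ≤ Fintype.card V) (x : V) : 1 ≤ conductance (star x) := by
  have hd : ∀ v, 0 < (star x).degree v := fun v => by
    by_cases hv : v = x
    · rw [hv, degree_star_self]; omega
    · rw [degree_star_of_ne hv]; exact one_pos
  by_contra! h
  obtain ⟨δ, h1, h2⟩ := exists_between h
  obtain ⟨S, hS, hle, hcut⟩ := exists_sparse_cut hn hd h1
  have h3 : (vol (star x) S : ℝ) ≤ cutSize (star x) S Sᶜ := by
    exact_mod_cast vol_star_le_cutSize x S hle
  have h4 : (1 : ℝ) ≤ vol (star x) S := by exact_mod_cast hS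
  nlinarith

lemma numEdges_star_le (x : V) : numEdges (star x) ≤ Fintype.card V := by
  have : (star x).edgeSet ⊆ Set.range fun v => s(x, v) := by
    intro e
    induction e with
    | _ u v =>
      rw [SimpleGraph.mem_edgeSet, star_adj]
      rintro ⟨-, rfl | rfl⟩
      · exact ⟨v, rfl⟩
      · exact ⟨u, Sym2.eq_swap⟩
  calc numEdges (star x) ≤ (Set.range fun v => s(x, v)).ncard :=
        Set.ncard_le_ncard this (Set.finite_range _)
    _ ≤ Nat.card V := by
        rw [← Set.image_univ, ← Set.ncard_univ]
        exact Set.ncard_image_le Set.finite_univ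
    _ = _ := Nat.card_eq_fintype_card

lemma card_le_two_mul_numEdges {G : SimpleGraph V} (hd : ∀ v, 0 < G.degree v) :
    Fintype.card V ≤ 2 * numEdges G := by
  have h1 : numEdges G = G.edgeFinset.card := by
    rw [numEdges, ← SimpleGraph.coe_edgeFinset, Set.ncard_coe_finset]
  rw [h1, ← SimpleGraph.sum_degrees_eq_twice_card_edges]
  calc Fintype.card V = ∑ v : V, 1 := by simp
    _ ≤ _ := Finset.sum_le_sum fun v _ => hd v

lemma editDist_le (G H : SimpleGraph V) : editDist G H ≤ numEdges G + numEdges H := by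
  have : symmDiff G.edgeSet H.edgeSet ⊆ G.edgeSet ∪ H.edgeSet := symmDiff_le_sup
  exact (Set.ncard_le_ncard this (Set.toFinite _)).trans (Set.ncard_union_le _ _)

/-- A graph without isolated vertices can be replaced by a star by at most `3 m` modifications. -/
lemma le_three_of_isFar {G : SimpleGraph V} (hn : 2 ≤ Fintype.card V)
    (hd : ∀ v, 0 < G.degree v) {ε δ : ℝ} (hδ : δ ≤ 1)
    (h : IsFar ε (fun G => δ ≤ conductance G) G) : ε ≤ 3 := by
  obtain ⟨x⟩ : Nonempty V := Fintype.card_pos_iff.1 (by omega)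
  have h1 := h (star x) (hδ.trans (one_le_conductance_star hn x))
  have h2 := card_le_two_mul_numEdges hd
  have h3 : editDist G (star x) ≤ 3 * numEdges G :=
    (editDist_le G (star x)).trans (by have := numEdges_star_le x; omega)
  have h4 : (editDist G (star x) : ℝ) ≤ 3 * numEdges G := by exact_mod_cast h3
  have h5 : (0 : ℝ) < numEdges G := by
    have : 0 < numEdges G := by omega
    exact_mod_cast this
  exact le_of_mul_le_mul_right (h1.trans h4) h5

lemma conductance_lt_of_isFar {G : SimpleGraph V} (hn : 2 ≤ Fintype.card V)
    (hd : ∀ v, 0 < G.degree v) {ε δ : ℝ} (hε : 0 < ε)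
    (h : IsFar ε (fun G => δ ≤ conductance G) G) : conductance G < δ := by
  by_contra! h0
  have h1 := h G h0
  have h2 := card_le_two_mul_numEdges hd
  have h3 : (0 : ℝ) < numEdges G := by
    have : 0 < numEdges G := by omega
    exact_mod_cast this
  simp only [editDist, symmDiff_self, Set.bot_eq_empty, Set.ncard_empty, Nat.cast_zero] at h1
  nlinarith

/-! ### Connected graphs -/

lemma abs_sub_le_of_walk {V : Type*} {G : SimpleGraph V} {f : V → ℝ} {s : ℝ}
    (h : ∀ u v, G.Adj u v → |f u - f v| ≤ s) {u v : V} (p : G.Walk u v) :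
    |f u - f v| ≤ p.length * s := by
  induction p with
  | nil => simp
  | cons hadj p ih =>
    have := abs_sub_le (f _) (f _) (f _) |>.trans (add_le_add (h _ _ hadj) ih)
    rw [SimpleGraph.Walk.length_cons]
    push_cast
    linarith

lemma abs_sub_le_of_connected {G : SimpleGraph V} (hG : G.Connected) {f : V → ℝ} {s : ℝ}
    (hs : 0 ≤ s) (h : ∀ u v, G.Adj u v → |f u - f v| ≤ s) (u v : V) :
    |f u - f v| ≤ Fintype.card V * s := by
  obtain ⟨p, hp⟩ := hG.exists_isPath u v
  refine (abs_sub_le_of_walk h p).trans (mul_le_mul_of_nonneg_right ?_ hs)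
  exact_mod_cast hp.length_lt.le

/-- On a connected graph, a function of mean zero cannot be close to a harmonic function. -/
lemma exists_abs_le_mul_abs_sub_avg {G : SimpleGraph V} (hd : ∀ v, 0 < G.degree v)
    (hG : G.Connected) {f : V → ℝ}
    (hf : (WeightedGraph.ofGraph G hd).inner (fun _ => 1) f = 0) :
    ∃ v, ∀ u, |f u| ≤ 2 * (Fintype.card V : ℝ) ^ 3 *
      ((WeightedGraph.ofGraph G hd).deg v * |f v - (WeightedGraph.ofGraph G hd).avg f v|) := by
  set W := WeightedGraph.ofGraph G hd with hW
  have hne : Nonempty V := hG.nonempty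
  obtain ⟨v, -, hv⟩ := Finset.exists_max_image Finset.univ
    (fun v => W.deg v * |f v - W.avg f v|) Finset.univ_nonempty
  obtain ⟨x, -, hx⟩ := Finset.exists_max_image Finset.univ (fun v => |f v|) Finset.univ_nonempty
  set s := W.deg v * |f v - W.avg f v| with hs
  set n : ℝ := (Fintype.card V : ℝ) with hn
  refine ⟨v, fun u => (hx u (Finset.mem_univ u)).trans ?_⟩
  -- The energy is at most `n * |f x| * s`.
  have h1 : W.energy f ≤ n * (|f x| * s) := by
    have e : W.energy f = ∑ u, f u * (W.deg u * (f u - W.avg f u)) := by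
      have := W.inner_avg_self_eq f
      have h' : W.energy f = W.inner f (f - W.avg f) := by rw [W.inner_sub_right]; linarith
      rw [h', WeightedGraph.inner]
      exact Finset.sum_congr rfl fun u _ => by simp only [Pi.sub_apply]; ring
    rw [e, hn, ← nsmul_eq_mul, ← Finset.card_univ, ← Finset.sum_const]
    refine Finset.sum_le_sum fun u _ => (le_abs_self _).trans ?_
    rw [abs_mul, abs_mul, abs_of_pos (W.deg_pos u)]
    exact mul_le_mul (hx u (Finset.mem_univ u)) (hv u (Finset.mem_univ u))
      (mul_nonneg (W.deg_pos u).le (abs_nonneg _)) (abs_nonneg _)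
  -- Every edge difference is bounded in terms of the energy.
  have h2 : ∀ u v, G.Adj u v → |f u - f v| ≤ √(2 * W.energy f) := fun u v huv => by
    apply Real.abs_le_sqrt
    have a1 := Finset.single_le_sum (f := fun v => W.w u v * (f u - f v) ^ 2)
      (fun v _ => mul_nonneg (W.nonneg u v) (sq_nonneg _)) (Finset.mem_univ v)
    have a2 := Finset.single_le_sum (f := fun u => ∑ v, W.w u v * (f u - f v) ^ 2)
      (fun u _ => Finset.sum_nonneg fun v _ => mul_nonneg (W.nonneg u v) (sq_nonneg _))
      (Finset.mem_univ u)
    have a3 : W.w u v = 1 := by simp [hW, WeightedGraph.ofGraph_w, huv]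
    simp only [a3, one_mul] at a1
    rw [WeightedGraph.energy]
    linarith
  have h3 := abs_sub_le_of_connected hG (Real.sqrt_nonneg _) h2 x
  -- As `f` has mean zero, it takes a value of the sign opposite to that of `f x`.
  obtain ⟨y, hy⟩ : ∃ y, f x * f y ≤ 0 := by
    by_contra! hall
    have : 0 < W.inner (fun _ => 1) (f x • f) :=
      Finset.sum_pos (fun u _ => mul_pos (W.deg_pos u) (by simpa using hall u))
        Finset.univ_nonempty
    rw [W.inner_smul_right, hf, mul_zero] at this
    exact lt_irrefl _ this
  have h4 : |f x| ≤ |f x - f y| := by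
    apply sq_le_sq.1
    nlinarith [sq_nonneg (f y)]
  have h5 : |f x| ≤ n * √(2 * W.energy f) := h4.trans (h3 y)
  have h6 : |f x| ^ 2 ≤ n ^ 2 * (2 * W.energy f) := by
    have := pow_le_pow_left₀ (abs_nonneg _) h5 2
    rwa [mul_pow, Real.sq_sqrt (by have := W.energy_nonneg f; linarith)] at this
  rcases (abs_nonneg (f x)).eq_or_lt with h0 | h0
  · rw [← h0]
    have := mul_nonneg (W.deg_pos v).le (abs_nonneg (f v - W.avg f v))
    positivity
  · have h7 : |f x| * |f x| ≤ (2 * n ^ 3 * s) * |f x| := by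
      have := mul_le_mul_of_nonneg_left h1 (by positivity : 0 ≤ 2 * n ^ 2)
      nlinarith
    exact le_of_mul_le_mul_right h7 h0

end Conductance

/-! ### Independent choices -/

section Choices

variable {V : Type*} [Fintype V]

lemma piPMF_apply {S : Type*} (p : V → PMF S) (σ : V → S) : piPMF p σ = ∏ v, p v (σ v) := rfl

lemma piPMF_map {S S' : Type*} (p : V → PMF S) (g : V → S → S') :
    piPMF (fun v => (p v).map (g v)) = (piPMF p).map fun r v => g v (r v) := by
  ext σ
  simp only [piPMF_apply, PMF.map_apply]
  rw [← tsum_prod_pi]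
  refine tsum_congr fun r => ?_
  rw [Finset.prod_ite_zero]
  simp only [Finset.mem_univ, true_implies, funext_iff]

lemma piPMF_pure {S : Type*} (σ : V → S) : piPMF (fun v => PMF.pure (σ v)) = PMF.pure σ := by
  ext τ
  simp only [piPMF_apply, PMF.pure_apply]
  rw [Finset.prod_ite_zero]
  simp [funext_iff]

lemma piPMF_uniform {S : Type*} [Fintype S] [Nonempty S] :
    piPMF (fun _ : V => PMF.uniformOfFintype S) = PMF.uniformOfFintype (V → S) := by
  ext σ
  simp only [piPMF_apply, PMF.uniformOfFintype_apply]
  rw [Finset.prod_const, Finset.card_univ, Fintype.card_fun, Nat.cast_pow, ENNReal.inv_pow]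

/-- If changing one of the independent uniform choices from `{0, 1, 2}` leads out of the
complement of an event, then the event has probability at least `2 / 3`. -/
lemma two_thirds_le_uniform (E : Set (V → Fin 3)) (v : V)
    (h : ∀ r ∉ E, ∀ r' ∉ E, (∀ u ≠ v, r u = r' u) → r v = r' v) :
    2 / 3 ≤ (PMF.uniformOfFintype (V → Fin 3)).toOuterMeasure E := by
  rw [PMF.toOuterMeasure_uniformOfFintype_apply]
  have hinj : Function.Injective fun x : (Eᶜ : Set (V → Fin 3)) × Fin 3 =>
      Function.update x.1.1 v x.2 := by
    rintro ⟨⟨r, hr⟩, j⟩ ⟨⟨r', hr'⟩, j'⟩ he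
    have h1 : ∀ u ≠ v, r u = r' u := fun u hu => by simpa [hu] using congrFun he u
    have h2 : j = j' := by simpa using congrFun he v
    have h3 : r = r' := by
      ext u
      by_cases hu : u = v
      · rw [hu, h r hr r' hr' h1]
      · rw [h1 u hu]
    simp [h2, h3]
  have h1 := Fintype.card_le_of_injective _ hinj
  rw [Fintype.card_prod, Fintype.card_fin, Fintype.card_compl_set] at h1
  have h2 : 2 * Fintype.card (V → Fin 3) ≤ 3 * Fintype.card E := by
    have := set_fintype_card_le_univ E; omega
  have h3 : (2 * (Fintype.card (V → Fin 3)) : ℝ≥0∞) ≤ 3 * (Fintype.card E : ℝ≥0∞) := by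
    exact_mod_cast h2
  have h4 : (Fintype.card (V → Fin 3) : ℝ≥0∞) ≠ 0 := by
    exact_mod_cast Fintype.card_ne_zero
  rw [ENNReal.le_div_iff_mul_le (Or.inl h4) (Or.inl (ENNReal.natCast_ne_top _)),
    ← ENNReal.mul_div_right_comm]
  refine ENNReal.div_le_of_le_mul ?_
  rwa [mul_comm (Fintype.card E : ℝ≥0∞)]

end Choices

/-! ### Simulation of rounds with long messages -/

/-- A deterministic protocol in which every vertex sends the same natural number to all of its
neighbours in every round. The numbers need not fit into a message of the CONGEST model. -/
structure BroadcastProtocol where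
  State : Type
  msg : State → ℕ
  update : (d : ℕ) → State → (Fin d → ℕ) → State

/-- The natural number with the given binary digits, least significant digit first. -/
def decodeBits (l : List Bool) : ℕ := l.foldr Nat.bit 0

lemma decodeBits_bits (n : ℕ) : decodeBits n.bits = n := by
  induction n using Nat.binaryRec' with
  | zero => simp [decodeBits]
  | bit b n h ih =>
    rw [Nat.bits_append_bit n b h, decodeBits, List.foldr_cons]
    exact congrArg (Nat.bit b) ih

/-- The state of a vertex while it simulates a broadcast protocol: the number `size` of vertices,
the number of rounds that have passed, the state `core` of the simulated protocol, and for every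
port the part of the current number that has been received through it. -/
structure SimState (S : Type) where
  size : ℕ
  round : ℕ
  core : S
  buffer : ℕ → ℕ

/-- Numbers are transmitted digit by digit, in the largest base `2 ^ b` that is at most `n`. -/
def digitBase (n : ℕ) : ℕ := 2 ^ Nat.log 2 n

namespace BroadcastProtocol

variable (B : BroadcastProtocol)

/-- The local computation of a vertex in one round of the simulation: it stores the digits that it
has received; after `k` rounds, the numbers are complete and it updates the simulated state. -/
def simStep (k d : ℕ) (s : SimState B.State) (msgs : Fin d → List Bool) : SimState B.State :=
  let buf : ℕ → ℕ := fun i => if h : i < d then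
    s.buffer i + digitBase s.size ^ (s.round % k) * decodeBits (msgs ⟨i, h⟩) else 0
  if (s.round + 1) % k = 0 then
    ⟨s.size, s.round + 1, B.update d s.core fun i => buf i, fun _ => 0⟩
  else ⟨s.size, s.round + 1, s.core, buf⟩

/-- The distributed algorithm that simulates `rounds n` rounds of a broadcast protocol on networks
with `n` vertices, spending `k` rounds on each of them. The initial state `start n i d r` depends on
private randomness `r`, and the output is determined by `verdict`. -/
def simulation {Ω : Type} (coins : PMF Ω) (start : ℕ → ℕ → ℕ → Ω → B.State) (k : ℕ)
    (rounds : ℕ → ℕ) (verdict : ℕ → B.State → Bool) : DistAlgorithm where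
  State := SimState B.State
  init n i d := coins.map fun r => ⟨n, 0, start n i d r, fun _ => 0⟩
  send _ s _ := (B.msg s.core / digitBase s.size ^ (s.round % k) % digitBase s.size).bits
  step d s msgs := PMF.pure (B.simStep k d s msgs)
  output s := if k * rounds s.size ≤ s.round then some (verdict s.size s.core) else none

variable {c : ℝ} {V : Type*} [Fintype V]

/-- One round of a broadcast protocol on a network. -/
def next (N : Network c V) (σ : V → B.State) (v : V) : B.State :=
  B.update (N.graph.degree v) (σ v) fun i => B.msg (σ (N.neighbor v i))

/-- The state of the vertices after `t` rounds of the simulation, which begins with the states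
`σ`. -/
def simulated (N : Network c V) (k : ℕ) (σ : V → B.State) (t : ℕ) (v : V) : SimState B.State where
  size := Fintype.card V
  round := t
  core := (B.next N)^[t / k] σ v
  buffer i := if h : i < N.graph.degree v then
    B.msg ((B.next N)^[t / k] σ (N.neighbor v ⟨i, h⟩)) % digitBase (Fintype.card V) ^ (t % k) else 0

lemma simStep_simulated (N : Network c V) {k : ℕ} (hk : 0 < k) (σ : V → B.State) (t : ℕ)
    (hmsg : ∀ v, B.msg ((B.next N)^[t / k] σ v) < digitBase (Fintype.card V) ^ k) (v : V) :
    B.simStep k (N.graph.degree v) (B.simulated N k σ t v) (fun i =>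
        (B.msg (B.simulated N k σ t (N.neighbor v i)).core / digitBase (Fintype.card V) ^ (t % k)
          % digitBase (Fintype.card V)).bits) =
      B.simulated N k σ (t + 1) v := by
  have hbuf : ∀ m, m % digitBase (Fintype.card V) ^ (t % k) + digitBase (Fintype.card V) ^ (t % k) *
      (m / digitBase (Fintype.card V) ^ (t % k) % digitBase (Fintype.card V)) =
      m % digitBase (Fintype.card V) ^ (t % k + 1) := fun m => by
    rw [pow_succ, Nat.mod_mul]
  have hlt : t % k < k := Nat.mod_lt _ hk
  by_cases h : (t + 1) % k = 0
  · have h1 : t % k + 1 = k := by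
      have := Nat.add_mod t 1 k
      rcases Nat.lt_or_ge (t % k + 1) k with h' | h'
      · rw [← Nat.mod_add_mod, Nat.mod_eq_of_lt h'] at h; omega
      · omega
    have h2 : (t + 1) / k = t / k + 1 := Nat.succ_div_of_dvd (Nat.dvd_of_mod_eq_zero h)
    simp only [simStep, simulated, h, if_true, decodeBits_bits, h2, Function.iterate_succ_apply',
      Fin.is_lt, dite_true, pow_zero, Nat.mod_one, hbuf]
    simp only [h1, Nat.mod_eq_of_lt (hmsg _)]
    simp [next]
  · have h1 : (t + 1) % k = t % k + 1 := by
      rcases Nat.lt_or_ge (t % k + 1) k with h' | h'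
      · rw [← Nat.mod_add_mod, Nat.mod_eq_of_lt h']
      · have h3 : t % k + 1 = k := by omega
        rw [← Nat.mod_add_mod, h3, Nat.mod_self] at h; omega
    have h2 : (t + 1) / k = t / k := Nat.succ_div_of_not_dvd fun hd =>
      h (Nat.mod_eq_zero_of_dvd hd)
    have h3 : ¬ t % k + 1 = 0 := Nat.succ_ne_zero _
    simp only [simStep, simulated, decodeBits_bits, h1, h2, h3, if_false]
    congr 1
    funext i
    split_ifs with hi
    · rw [hbuf]
    · rfl

variable {Ω : Type} (coins : PMF Ω) (start : ℕ → ℕ → ℕ → Ω → B.State) (k : ℕ)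
    (rounds : ℕ → ℕ) (verdict : ℕ → B.State → Bool)

/-- The initial states of the simulated protocol for given random choices. -/
def initial (N : Network c V) (r : V → Ω) (v : V) : B.State :=
  start (Fintype.card V) (N.id v) (N.graph.degree v) (r v)

/-- The states of the vertices after `t` rounds of the distributed algorithm for given random
choices. -/
def trace (N : Network c V) (t : ℕ) (r : V → Ω) :
    V → (B.simulation coins start k rounds verdict).State :=
  B.simulated N k (B.initial start N r) (min t (k * rounds (Fintype.card V)))

lemma simulation_run (N : Network c V) (hk : 0 < k)
    (hmsg : ∀ r j v, j < rounds (Fintype.card V) →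
      B.msg ((B.next N)^[j] (B.initial start N r) v) < digitBase (Fintype.card V) ^ k) (t : ℕ) :
    (B.simulation coins start k rounds verdict).run N t =
      (piPMF fun _ : V => coins).map (B.trace coins start k rounds verdict N t) := by
  induction t with
  | zero =>
    refine (piPMF_map (fun _ : V => coins) fun v r => _).trans (congrArg (PMF.map · _) ?_)
    funext r v
    simp [trace, simulated, initial, Nat.mod_one]
  | succ t ih =>
    rw [DistAlgorithm.run, ih, PMF.bind_map, ← PMF.bind_pure_comp]
    congr 1
    funext r
    simp only [Function.comp]
    rw [← piPMF_pure]
    congr 1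
    funext v
    rcases Nat.lt_or_ge t (k * rounds (Fintype.card V)) with h | h
    · have e : ∀ v, ((B.simulation coins start k rounds verdict).output
          (B.trace coins start k rounds verdict N t r v)) = none := fun v => by
        simp [simulation, trace, simulated, min_eq_left h.le, h]
      have e1 : B.trace coins start k rounds verdict N t r =
          B.simulated N k (B.initial start N r) t := by rw [trace, min_eq_left h.le]
      have e2 : B.trace coins start k rounds verdict N (t + 1) r =
          B.simulated N k (B.initial start N r) (t + 1) := by
        rw [trace, min_eq_left (Nat.succ_le_of_lt h)]
      rw [DistAlgorithm.nextState, e]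
      simp only [Option.isSome_none, Bool.false_eq_true, if_false]
      rw [e2, ← B.simStep_simulated N hk _ t fun v => hmsg r _ v (Nat.div_lt_of_lt_mul h)]
      have e' : (B.simulation coins start k rounds verdict).received N
          (B.trace coins start k rounds verdict N t r) v = fun i =>
          (B.msg (B.simulated N k (B.initial start N r) t (N.neighbor v i)).core /
            digitBase (Fintype.card V) ^ (t % k) % digitBase (Fintype.card V)).bits := by
        funext i
        rw [DistAlgorithm.received, DistAlgorithm.message, e]
        simp only [Option.isSome_none, Bool.false_eq_true, if_false]
        rw [e1]
        rfl
      rw [e', e1]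
      rfl
    · have e : B.trace coins start k rounds verdict N (t + 1) r =
          B.trace coins start k rounds verdict N t r := by
        rw [trace, trace, min_eq_right h, min_eq_right (h.trans (Nat.le_succ t))]
      rw [DistAlgorithm.nextState, if_pos, e]
      simp [simulation, trace, simulated, min_eq_right h]

lemma simulation_respectsBandwidth (N : Network c V) (hc : 1 ≤ c) (hn : 2 ≤ Fintype.card V)
    (hk : 0 < k)
    (hmsg : ∀ r j v, j < rounds (Fintype.card V) →
      B.msg ((B.next N)^[j] (B.initial start N r) v) < digitBase (Fintype.card V) ^ k) :
    (B.simulation coins start k rounds verdict).RespectsBandwidth N := by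
  intro t σ hσ v i
  rw [B.simulation_run coins start k rounds verdict N hk hmsg, PMF.mem_support_map_iff] at hσ
  obtain ⟨r, -, rfl⟩ := hσ
  have hlog : (0 : ℝ) ≤ Real.logb 2 (Fintype.card V) :=
    Real.logb_nonneg one_lt_two (by exact_mod_cast (by omega : 1 ≤ Fintype.card V))
  rw [DistAlgorithm.message]
  split_ifs
  · simpa using mul_nonneg (by linarith) hlog
  · have h1 : ((B.simulation coins start k rounds verdict).send (N.graph.degree v)
        (B.trace coins start k rounds verdict N t r v) i).length
        ≤ Nat.log 2 (Fintype.card V) := by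
      refine (Nat.size_eq_bits_len _).trans_le (Nat.size_le.2 ?_)
      exact Nat.mod_lt _ (by simp [digitBase])
    have h2 : (Nat.log 2 (Fintype.card V) : ℝ) ≤ Real.logb 2 (Fintype.card V) :=
      Real.natLog_le_logb _ _
    calc _ ≤ (Nat.log 2 (Fintype.card V) : ℝ) := by exact_mod_cast h1
      _ ≤ Real.logb 2 (Fintype.card V) := h2
      _ ≤ _ := le_mul_of_one_le_left hlog hc

/-- After the simulated protocol has ended, every vertex has terminated with its verdict. -/
lemma simulation_output (N : Network c V) (hk : 0 < k) {t : ℕ}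
    (ht : k * rounds (Fintype.card V) ≤ t) (r : V → Ω) (v : V) :
    (B.simulation coins start k rounds verdict).output
      (B.trace coins start k rounds verdict N t r v) =
      some (verdict (Fintype.card V)
        ((B.next N)^[rounds (Fintype.card V)] (B.initial start N r) v)) := by
  simp [simulation, trace, min_eq_right ht, simulated, Nat.mul_div_cancel_left _ hk]

end BroadcastProtocol

/-! ### The conductance protocol -/

/-- The scale of the fixed point arithmetic: the number `x` is represented by `x * scale n`, up to
the shift by `origin n` that makes it nonnegative. The exponent `40` leaves room for `tolerance`. -/
def scale (n : ℕ) : ℕ := n ^ 40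

/-- The natural number that represents `0`. -/
def origin (n : ℕ) : ℕ := 2 * n * scale n

/-- The largest deviation from `0`, in units of `1 / scale n`, that is accepted at the end. It
exceeds the rounding errors, which are below `n ^ 16`. On graphs of small conductance, the deviation
is of a larger order than `n ^ 20` for most random choices. -/
def tolerance (n : ℕ) : ℕ := n ^ 20

/-- The state of a vertex: the number of vertices, its identifier and its random number, which do
not change; the number of rounds that have passed; the largest identifier that it has seen; and
its current value. -/
structure WalkState where
  size : ℕ
  id : ℕ
  coin : ℕ
  clock : ℕ
  best : ℕ
  value : ℕ

/-- The number that a vertex sends in the protocol `walkProtocol`. -/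
def walkMsg (length : ℕ → ℕ) (s : WalkState) : ℕ :=
  if s.clock < length s.size then s.best
  else if s.clock = length s.size then s.coin else s.value

/-- The local computation of a vertex of degree `d` in the protocol `walkProtocol`. -/
def walkUpdate (length : ℕ → ℕ) (d : ℕ) (s : WalkState) (m : Fin d → ℕ) : WalkState :=
  if s.clock < length s.size then
    { s with clock := s.clock + 1, best := max s.best (Finset.univ.sup m) }
  else if s.clock = length s.size then
    { s with
      clock := s.clock + 1
      value := (origin s.size * d + scale s.size + scale s.size * d * s.coin
        - ((if s.best = s.id then scale s.size * s.size else 0)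
          + scale s.size * ∑ i, m i)) / d }
  else { s with clock := s.clock + 1, value := (d * s.value + ∑ i, m i) / (2 * d) }

/-- For `T = length n` rounds the largest identifier is spread. A vertex that has not seen a larger
identifier than its own considers itself a leader. In one further round, the random numbers are
exchanged, and a function is set up that takes the value
`(1 - n * [v is a leader]) / deg v + coin v - (average of coin over the neighbours)` at `v`.
In the last `T` rounds, this function evolves according to the lazy random walk. All numbers are
rounded down. (At an isolated vertex, the value becomes `0` through a division by `0`, which does
not represent a number close to `0`.) -/
def walkProtocol (length : ℕ → ℕ) : BroadcastProtocol where
  State := WalkState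
  msg := walkMsg length
  update := walkUpdate length

/-- The initial state of a vertex. -/
def walkStart (n i _d : ℕ) (r : Fin 3) : WalkState := ⟨n, i, r, 0, i, 0⟩

/-- A vertex accepts if its value is close to `0`. -/
def walkVerdict (n : ℕ) (s : WalkState) : Bool :=
  decide (origin n ≤ s.value + tolerance n ∧ s.value ≤ origin n + tolerance n)

section Trajectory

variable {c : ℝ} {V : Type*} [Fintype V] (N : Network c V) (length : ℕ → ℕ) (r : V → Fin 3)

/-- The state of a vertex after `j` rounds of the protocol. -/
def trajectory (j : ℕ) (v : V) : WalkState :=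
  ((walkProtocol length).next N)^[j] ((walkProtocol length).initial walkStart N r) v

lemma trajectory_succ (j : ℕ) (v : V) : trajectory N length r (j + 1) v =
    walkUpdate length (N.graph.degree v) (trajectory N length r j v) fun i =>
      walkMsg length (trajectory N length r j (N.neighbor v i)) := by
  simp only [trajectory, Function.iterate_succ_apply']
  rfl

lemma trajectory_zero (v : V) : trajectory N length r 0 v =
    ⟨Fintype.card V, N.id v, r v, 0, N.id v, 0⟩ := rfl

lemma trajectory_const (j : ℕ) (v : V) :
    (trajectory N length r j v).size = Fintype.card V ∧ (trajectory N length r j v).id = N.id v ∧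
      (trajectory N length r j v).coin = r v ∧ (trajectory N length r j v).clock = j := by
  induction j generalizing v with
  | zero => simp [trajectory_zero]
  | succ j ih =>
    obtain ⟨h1, h2, h3, h4⟩ := ih v
    rw [trajectory_succ, walkUpdate]
    split_ifs <;> simp [h1, h2, h3, h4]

/-- The largest identifier at distance at most `j`. -/
def maxId : ℕ → V → ℕ
  | 0, v => N.id v
  | j + 1, v => max (maxId j v) (Finset.univ.sup fun i => maxId j (N.neighbor v i))

lemma trajectory_best (j : ℕ) (hj : j ≤ length (Fintype.card V)) (v : V) :
    (trajectory N length r j v).best = maxId N j v := by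
  induction j generalizing v with
  | zero => simp [trajectory_zero, maxId]
  | succ j ih =>
    have hj' : j < length (Fintype.card V) := hj
    rw [trajectory_succ]
    simp [walkUpdate, walkMsg, trajectory_const, hj', ih hj'.le, maxId]

lemma trajectory_value_start (v : V) :
    (trajectory N length r (length (Fintype.card V) + 1) v).value =
      (origin (Fintype.card V) * N.graph.degree v + scale (Fintype.card V)
        + scale (Fintype.card V) * N.graph.degree v * r v
        - ((if maxId N (length (Fintype.card V)) v = N.id v then
            scale (Fintype.card V) * Fintype.card V else 0)
          + scale (Fintype.card V) * ∑ i, (r (N.neighbor v i) : ℕ))) / N.graph.degree v := by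
  rw [trajectory_succ]
  simp [walkUpdate, walkMsg, trajectory_const, trajectory_best]

lemma trajectory_value_succ (j : ℕ) (hj : length (Fintype.card V) < j) (v : V) :
    (trajectory N length r (j + 1) v).value =
      (N.graph.degree v * (trajectory N length r j v).value
        + ∑ i, (trajectory N length r j (N.neighbor v i)).value) / (2 * N.graph.degree v) := by
  rw [trajectory_succ]
  simp [walkUpdate, walkMsg, trajectory_const, hj.not_gt, hj.ne']

lemma trajectory_value_of_degree_eq_zero {v : V} (hv : N.graph.degree v = 0) (j : ℕ) :
    (trajectory N length r (length (Fintype.card V) + 1 + j) v).value = 0 := by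
  have h0 : ∀ a b : ℕ, b = 0 → a / b = 0 := fun a b hb => by rw [hb, Nat.div_zero]
  cases j with
  | zero => rw [Nat.add_zero, trajectory_value_start, h0 _ _ hv]
  | succ j =>
    rw [← Nat.add_assoc, trajectory_value_succ _ _ _ _ (by omega), h0 _ _ (by rw [hv])]

/-! ### Sizes of the messages -/

lemma maxId_le_of_closed {K : Set V} (hK : ∀ u v, u ∈ K → N.graph.Adj u v → v ∈ K) {b : ℕ}
    (hb : ∀ v ∈ K, N.id v ≤ b) (j : ℕ) : ∀ v ∈ K, maxId N j v ≤ b := by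
  induction j with
  | zero => exact hb
  | succ j ih =>
    intro v hv
    exact max_le (ih v hv) (Finset.sup_le fun i _ => ih _ (hK v _ hv (N.port v i).2))

lemma id_le_maxId (j : ℕ) (v : V) : N.id v ≤ maxId N j v := by
  induction j with
  | zero => exact le_rfl
  | succ j ih => exact ih.trans (le_max_left _ _)

lemma id_le_pow (v : V) : N.id v ≤ Fintype.card V ^ ⌈c⌉₊ := by
  have h1 : (1 : ℝ) ≤ Fintype.card V := by
    exact_mod_cast Fintype.card_pos_iff.2 ⟨v⟩
  have h2 : (N.id v : ℝ) ≤ (Fintype.card V : ℝ) ^ ⌈c⌉₊ := by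
    rw [← Real.rpow_natCast]
    exact (N.id_le v).trans (Real.rpow_le_rpow_of_exponent_le h1 (Nat.le_ceil c))
  exact_mod_cast h2

lemma trajectory_value_le (hn : 2 ≤ Fintype.card V) (j : ℕ) (v : V) :
    (trajectory N length r (length (Fintype.card V) + 1 + j) v).value ≤
      4 * Fintype.card V * scale (Fintype.card V) := by
  induction j generalizing v with
  | zero =>
    rcases Nat.eq_zero_or_pos (N.graph.degree v) with h0 | hd
    · rw [trajectory_value_of_degree_eq_zero N length r h0]; exact Nat.zero_le _
    rw [Nat.add_zero, trajectory_value_start]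
    refine (Nat.div_le_div_right (Nat.sub_le _ _)).trans ?_
    refine Nat.div_le_of_le_mul ?_
    have h3 : (r v : ℕ) ≤ 2 := by omega
    have h4 : scale (Fintype.card V) * N.graph.degree v * (r v : ℕ) ≤
        scale (Fintype.card V) * N.graph.degree v * 2 := Nat.mul_le_mul_left _ h3
    have h5 : scale (Fintype.card V) ≤ scale (Fintype.card V) * N.graph.degree v :=
      Nat.le_mul_of_pos_right _ hd
    have h6 := Nat.mul_le_mul_left (scale (Fintype.card V) * N.graph.degree v) hn
    rw [origin]
    nlinarith
  | succ j ih =>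
    rcases Nat.eq_zero_or_pos (N.graph.degree v) with h0 | hd
    · rw [trajectory_value_of_degree_eq_zero N length r h0]; exact Nat.zero_le _
    rw [← Nat.add_assoc, trajectory_value_succ _ _ _ _ (by omega)]
    refine Nat.div_le_of_le_mul ?_
    have h1 := Nat.mul_le_mul_left (N.graph.degree v) (ih v)
    have h2 := Finset.sum_le_sum fun i (_ : i ∈ (Finset.univ : Finset (Fin (N.graph.degree v)))) =>
      ih (N.neighbor v i)
    rw [Finset.sum_const, Finset.card_univ, Fintype.card_fin, smul_eq_mul] at h2
    nlinarith

/-- The number of digits that suffice for all messages. -/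
def numDigits (c : ℝ) : ℕ := 2 * (⌈c⌉₊ + 43)

lemma pow_lt_digitBase_pow {n : ℕ} (hn : 2 ≤ n) {e : ℕ} (c : ℝ) (he : e ≤ ⌈c⌉₊ + 43) :
    n ^ e < digitBase n ^ numDigits c := by
  have hlog : 1 ≤ Nat.log 2 n := Nat.log_pos one_lt_two hn
  have h1 : n < digitBase n ^ 2 := by
    rw [digitBase, ← pow_mul]
    exact (Nat.lt_pow_succ_log_self one_lt_two n).trans_le
      (Nat.pow_le_pow_right two_pos (by omega))
  calc n ^ e ≤ n ^ (⌈c⌉₊ + 43) := Nat.pow_le_pow_right (by omega) he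
    _ < (digitBase n ^ 2) ^ (⌈c⌉₊ + 43) := Nat.pow_lt_pow_left h1 (by omega)
    _ = _ := by rw [numDigits, pow_mul]

lemma msg_lt (hn : 2 ≤ Fintype.card V) (j : ℕ) (v : V) :
    walkMsg length (trajectory N length r j v) <
      digitBase (Fintype.card V) ^ numDigits c := by
  obtain ⟨h1, -, h3, h4⟩ := trajectory_const N length r j v
  simp only [walkMsg, h1, h3, h4]
  split_ifs with h h'
  · rw [trajectory_best N length r j h.le]
    exact (maxId_le_of_closed N (K := Set.univ) (fun _ _ _ _ => trivial)
      (fun v _ => id_le_pow N v) j v trivial).trans_lt (pow_lt_digitBase_pow hn c (by omega))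
  · refine lt_of_le_of_lt ?_ (pow_lt_digitBase_pow hn c (e := 1) (by omega))
    rw [pow_one]; omega
  · obtain ⟨i, rfl⟩ : ∃ i, j = length (Fintype.card V) + 1 + i :=
      ⟨j - (length (Fintype.card V) + 1), by omega⟩
    refine (trajectory_value_le N length r hn i v).trans_lt
      (lt_of_le_of_lt ?_ (pow_lt_digitBase_pow hn c (e := 43) (by omega)))
    rw [scale]
    have : 4 ≤ Fintype.card V ^ 2 := by nlinarith
    calc 4 * Fintype.card V * Fintype.card V ^ 40 = 4 * Fintype.card V ^ 41 := by ring
      _ ≤ Fintype.card V ^ 2 * Fintype.card V ^ 41 := Nat.mul_le_mul_right _ this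
      _ = _ := by ring

/-! ### Comparison with the exact lazy walk -/

lemma sum_neighbor {M : Type*} [AddCommMonoid M] (F : V → M) (v : V) :
    ∑ i, F (N.neighbor v i) = ∑ u, if N.graph.Adj v u then F u else 0 := by
  rw [← Finset.sum_filter]
  have h := (N.port v).sum_comp (fun u => F (u : V))
  simp only [Network.neighbor]
  rw [h]
  exact (Finset.sum_subtype _ (by simp) F).symm

variable (hd : ∀ v, 0 < N.graph.degree v)

/-- The weighted graph that underlies a network. -/
abbrev walkGraph : WeightedGraph V := WeightedGraph.ofGraph N.graph hd

lemma sum_neighbor_eq_deg_mul_avg (F : V → ℝ) (v : V) :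
    ∑ i, F (N.neighbor v i) = N.graph.degree v * (walkGraph N hd).avg F v := by
  rw [← WeightedGraph.ofGraph_deg N.graph hd, WeightedGraph.deg_mul_avg, sum_neighbor]
  simp [WeightedGraph.ofGraph_w]

/-- The indicator function of the leaders. -/
def leader (T : ℕ) (v : V) : ℝ := if maxId N T v = N.id v then 1 else 0

/-- The random function from which the random walk starts, in exact arithmetic and before
scaling. -/
def startVector (T : ℕ) (v : V) : ℝ :=
  (1 - Fintype.card V * leader N T v) / N.graph.degree v
    + ((r v : ℝ) - (walkGraph N hd).avg (fun u => (r u : ℝ)) v)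

lemma abs_natCast_div_sub_le (a b : ℕ) : |((a / b : ℕ) : ℝ) - (a : ℝ) / b| ≤ 1 := by
  have h1 : ((a / b : ℕ) : ℝ) ≤ (a : ℝ) / b := Nat.cast_div_le
  have h2 : (a : ℝ) / b < (a / b : ℕ) + 1 := by
    rw [← Nat.floor_div_eq_div (K := ℝ)]; exact Nat.lt_floor_add_one _
  rw [abs_le]; constructor <;> linarith

lemma abs_avg_coin_le (v : V) : |(walkGraph N hd).avg (fun u => (r u : ℝ)) v| ≤ 2 :=
  (walkGraph N hd).abs_avg_le (fun u => by
    rw [abs_of_nonneg (Nat.cast_nonneg _)]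
    exact_mod_cast (by omega : (r u : ℕ) ≤ 2)) v

lemma abs_trajectory_value_start_sub_le (hn : 2 ≤ Fintype.card V) (v : V) :
    |((trajectory N length r (length (Fintype.card V) + 1) v).value : ℝ)
      - origin (Fintype.card V)
      - scale (Fintype.card V) * startVector N r hd (length (Fintype.card V)) v| ≤ 1 := by
  rw [trajectory_value_start]
  set n := Fintype.card V
  set M := scale n
  set d := N.graph.degree v
  set A := (walkGraph N hd).avg (fun u => (r u : ℝ)) v with hA
  have hd0 : 0 < d := hd v
  have hsum : ((∑ i, (r (N.neighbor v i) : ℕ) : ℕ) : ℝ) = d * A := by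
    push_cast
    exact sum_neighbor_eq_deg_mul_avg N hd (fun u => (r u : ℝ)) v
  have hsum2 : ∑ i, (r (N.neighbor v i) : ℕ) ≤ d * 2 := by
    calc _ ≤ ∑ i : Fin d, 2 := Finset.sum_le_sum fun i _ => by omega
      _ = d * 2 := by simp
  -- The subtraction of natural numbers does not truncate.
  have hle : (if maxId N (length n) v = N.id v then M * n else 0)
      + M * ∑ i, (r (N.neighbor v i) : ℕ) ≤ origin n * d + M + M * d * r v := by
    have h1 : (if maxId N (length n) v = N.id v then M * n else 0) ≤ M * n := by
      split_ifs <;> simp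
    have h2 := Nat.mul_le_mul_left M hsum2
    have h3 : M * n ≤ M * n * d := Nat.le_mul_of_pos_right _ hd0
    have h4 : M * d * 2 ≤ M * d * n := Nat.mul_le_mul_left _ hn
    have e : origin n * d = M * n * d + M * d * n := by
      change 2 * n * M * d = _; ring
    rw [e, add_assoc _ M]
    exact (add_le_add (h1.trans h3) (h2.trans (by rwa [← mul_assoc]))).trans
      (Nat.le_add_right _ _)
  have h := abs_natCast_div_sub_le (origin n * d + M + M * d * r v
    - ((if maxId N (length n) v = N.id v then M * n else 0)
      + M * ∑ i, (r (N.neighbor v i) : ℕ))) d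
  have hd' : (d : ℝ) ≠ 0 := by exact_mod_cast hd0.ne'
  have e : ((origin n * d + M + M * d * r v
      - ((if maxId N (length n) v = N.id v then M * n else 0)
        + M * ∑ i, (r (N.neighbor v i) : ℕ)) : ℕ) : ℝ) / d =
      origin n + M * startVector N r hd (length n) v := by
    rw [Nat.cast_sub hle, Nat.cast_add _ (M * _), Nat.cast_mul M (∑ i, _), hsum, startVector,
      leader, ← hA]
    change _ / (d : ℝ) = (origin n : ℝ) + (M : ℝ) * ((1 - (n : ℝ) * _) / (d : ℝ) + _)
    push_cast
    split_ifs <;> field_simp <;> ring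
  rw [e] at h
  rwa [sub_sub]

lemma abs_trajectory_value_sub_le (hn : 2 ≤ Fintype.card V) (t : ℕ) (v : V) :
    |((trajectory N length r (length (Fintype.card V) + 1 + t) v).value : ℝ)
      - origin (Fintype.card V) - scale (Fintype.card V) *
        (walkGraph N hd).lazy^[t] (startVector N r hd (length (Fintype.card V))) v| ≤ t + 1 := by
  have hsmul : ∀ t (s : ℝ) (F : V → ℝ),
      (walkGraph N hd).lazy^[t] (s • F) = s • (walkGraph N hd).lazy^[t] F := fun t s F => by
    induction t generalizing F with
    | zero => rfl
    | succ t ih =>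
      have : (walkGraph N hd).lazy (s • F) = s • (walkGraph N hd).lazy F := by
        rw [WeightedGraph.lazy_eq, WeightedGraph.lazy_eq, WeightedGraph.avg_smul]; module
      rw [Function.iterate_succ_apply, this, ih, Function.iterate_succ_apply]
  have key := (walkGraph N hd).abs_sub_lazy_iterate_le
    (F := (scale (Fintype.card V) : ℝ) • startVector N r hd (length (Fintype.card V)))
    (f := fun t => (fun v =>
      ((trajectory N length r (length (Fintype.card V) + 1 + t) v).value : ℝ)) -
        fun _ => (origin (Fintype.card V) : ℝ))
    (abs_trajectory_value_start_sub_le N length r hd hn) (fun t u => by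
      rw [WeightedGraph.lazy_sub, WeightedGraph.lazy_const]
      simp only [Pi.sub_apply, sub_sub_sub_cancel_right]
      rw [← Nat.add_assoc, trajectory_value_succ _ _ _ _ (by omega)]
      convert abs_natCast_div_sub_le _ _ using 3
      rw [WeightedGraph.lazy]
      have h := sum_neighbor_eq_deg_mul_avg N hd (fun v =>
        ((trajectory N length r (length (Fintype.card V) + 1 + t) v).value : ℝ)) u
      have hd' : (N.graph.degree u : ℝ) ≠ 0 := by exact_mod_cast (hd u).ne'
      push_cast
      rw [h]
      field_simp) t v
  rw [hsmul] at key
  exact key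

end Trajectory

/-! ### The number of steps of the walk -/

/-- Connected graphs on `n` vertices have conductance at least `1 / n ^ 2`, so that smaller lower
bounds on the conductance can be replaced by `1 / n ^ 2`. -/
def effectiveBound (Φ : ℝ) (n : ℕ) : ℝ := max Φ (1 / (n : ℝ) ^ 2)

/-- The number of steps of the lazy random walk. The factor `400` is large enough for
`pow_walkLength_mul_le_one` and small enough for `one_le_pow_walkLength_mul`. -/
def walkLength (Φ : ℝ) (n : ℕ) : ℕ := ⌈400 * Real.log n / effectiveBound Φ n ^ 2⌉₊

section Numerics

variable {Φ : ℝ} {n : ℕ}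

lemma effectiveBound_pos (hn : 2 ≤ n) : 0 < effectiveBound Φ n :=
  lt_max_of_lt_right (by positivity)

lemma effectiveBound_le_one (hn : 2 ≤ n) (hΦ : Φ ≤ 1) : effectiveBound Φ n ≤ 1 := by
  refine max_le hΦ (div_le_one_of_le₀ ?_ (by positivity))
  have : (1 : ℝ) ≤ n := by exact_mod_cast (by omega : 1 ≤ n)
  exact one_le_pow₀ this

lemma one_le_two_mul_log (hn : 2 ≤ n) : 1 ≤ 2 * Real.log n := by
  have h1 := Real.log_two_gt_d9
  have h2 : Real.log 2 ≤ Real.log n :=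
    Real.log_le_log two_pos (by exact_mod_cast hn)
  linarith

lemma walkLength_le_mul_log (hn : 2 ≤ n) (hΦ : 0 < Φ) (hΦ1 : Φ ≤ 1) :
    (2 * walkLength Φ n + 1 : ℝ) ≤ 806 * Real.log n / Φ ^ 2 := by
  have hlog := one_le_two_mul_log hn
  have hφ := effectiveBound_pos (Φ := Φ) hn
  have h1 : (walkLength Φ n : ℝ) < 400 * Real.log n / effectiveBound Φ n ^ 2 + 1 :=
    Nat.ceil_lt_add_one (by have : 0 ≤ Real.log n := by linarith
                            positivity)
  have h2 : 400 * Real.log n / effectiveBound Φ n ^ 2 ≤ 400 * Real.log n / Φ ^ 2 :=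
    div_le_div_of_nonneg_left (by linarith) (by positivity)
      (pow_le_pow_left₀ hΦ.le (le_max_left _ _) 2)
  have h3 : 1 ≤ 2 * Real.log n / Φ ^ 2 := by
    rw [le_div_iff₀ (by positivity)]
    nlinarith
  have h4 : 806 * Real.log n / Φ ^ 2 =
      2 * (400 * Real.log n / Φ ^ 2) + 3 * (2 * Real.log n / Φ ^ 2) := by ring
  linarith

/-- The rounding errors, at most `1` per step, are polynomial in `n`, uniformly in `Φ`. -/
lemma walkLength_add_one_le (hn : 2 ≤ n) : (walkLength Φ n + 1 : ℝ) ≤ (n : ℝ) ^ 16 := by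
  have hn' : (2 : ℝ) ≤ n := by exact_mod_cast hn
  have hlog := one_le_two_mul_log hn
  have hφ := effectiveBound_pos (Φ := Φ) hn
  have h1 : (walkLength Φ n : ℝ) < 400 * Real.log n / effectiveBound Φ n ^ 2 + 1 :=
    Nat.ceil_lt_add_one (by have : 0 ≤ Real.log n := by linarith
                            positivity)
  have h2 : 400 * Real.log n / effectiveBound Φ n ^ 2 ≤ 400 * Real.log n * (n : ℝ) ^ 4 := by
    rw [div_le_iff₀ (by positivity)]
    have h3 : 1 / (n : ℝ) ^ 2 ≤ effectiveBound Φ n := le_max_right _ _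
    have h4 := pow_le_pow_left₀ (by positivity) h3 2
    have h5 : 1 ≤ (n : ℝ) ^ 4 * effectiveBound Φ n ^ 2 := by
      calc (1 : ℝ) = (n : ℝ) ^ 4 * (1 / (n : ℝ) ^ 2) ^ 2 := by field_simp
        _ ≤ _ := mul_le_mul_of_nonneg_left h4 (by positivity)
    rw [mul_assoc]
    exact le_mul_of_one_le_right (by linarith) h5
  have h6 : Real.log n ≤ n := (Real.log_le_sub_one_of_pos (by linarith)).trans (by linarith)
  have h7 : 400 * Real.log n * (n : ℝ) ^ 4 ≤ 400 * (n : ℝ) ^ 5 := by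
    have := mul_le_mul_of_nonneg_right h6 (by positivity : 0 ≤ 400 * (n : ℝ) ^ 4)
    nlinarith
  have h8 : (400 : ℝ) ≤ (n : ℝ) ^ 9 := by
    calc (400 : ℝ) ≤ 2 ^ 9 := by norm_num
      _ ≤ _ := pow_le_pow_left₀ two_pos.le hn' 9
  have h9 : (n : ℝ) ^ 14 = (n : ℝ) ^ 9 * (n : ℝ) ^ 5 := by ring
  have h10 := mul_le_mul_of_nonneg_right h8 (by positivity : 0 ≤ (n : ℝ) ^ 5)
  have h11 : (2 : ℝ) ≤ (n : ℝ) ^ 14 := by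
    calc (2 : ℝ) ≤ 2 ^ 14 := by norm_num
      _ ≤ _ := pow_le_pow_left₀ two_pos.le hn' 14
  have h12 : (n : ℝ) ^ 16 = (n : ℝ) ^ 2 * (n : ℝ) ^ 14 := by ring
  have h13 := mul_le_mul_of_nonneg_right (by nlinarith : (2 : ℝ) ≤ (n : ℝ) ^ 2)
    (by positivity : 0 ≤ (n : ℝ) ^ 14)
  linarith

/-- On graphs of large conductance, all deviations from the stationary state become negligible. -/
lemma pow_walkLength_mul_le_one (hn : 2 ≤ n) (hΦ1 : Φ ≤ 1) :
    (1 - effectiveBound Φ n ^ 2 / 2 / 2) ^ walkLength Φ n * (n : ℝ) ^ 100 ≤ 1 := by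
  have hn' : (0 : ℝ) < n := by exact_mod_cast (by omega : 0 < n)
  have hφ := effectiveBound_pos (Φ := Φ) hn
  have hφ1 := effectiveBound_le_one (Φ := Φ) hn hΦ1
  set φ := effectiveBound Φ n with hφ_def
  have h1 : 400 * Real.log n / φ ^ 2 ≤ walkLength Φ n := Nat.le_ceil _
  rw [div_le_iff₀ (by positivity)] at h1
  have h2 : 1 - φ ^ 2 / 2 / 2 ≤ Real.exp (-(φ ^ 2 / 4)) := by
    have := Real.add_one_le_exp (-(φ ^ 2 / 4)); linarith
  calc _ ≤ Real.exp (-(φ ^ 2 / 4)) ^ walkLength Φ n * Real.exp (100 * Real.log n) := by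
        have e : (n : ℝ) ^ 100 = Real.exp (100 * Real.log n) := by
          rw [mul_comm, Real.exp_mul, Real.exp_log hn']; norm_num
        rw [e]
        refine mul_le_mul_of_nonneg_right (pow_le_pow_left₀ ?_ h2 _) (Real.exp_pos _).le
        nlinarith
    _ = Real.exp (walkLength Φ n * -(φ ^ 2 / 4) + 100 * Real.log n) := by
        rw [← Real.exp_nat_mul, Real.exp_add]
    _ ≤ 1 := Real.exp_le_one_iff.2 (by linarith)

/-- On graphs with a cut of small conductance, the deviation that is due to this cut persists. -/
lemma one_le_pow_walkLength_mul (hn : 2 ≤ n) (hΦ1 : Φ ≤ 1) :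
    1 ≤ (1 - effectiveBound Φ n ^ 2 / 1000) ^ walkLength Φ n * (n : ℝ) := by
  have hn' : (0 : ℝ) < n := by exact_mod_cast (by omega : 0 < n)
  have hφ := effectiveBound_pos (Φ := Φ) hn
  have hφ1 := effectiveBound_le_one (Φ := Φ) hn hΦ1
  have hlog := one_le_two_mul_log hn
  set φ := effectiveBound Φ n with hφ_def
  have h1 : (walkLength Φ n : ℝ) < 400 * Real.log n / φ ^ 2 + 1 :=
    Nat.ceil_lt_add_one (by have : 0 ≤ Real.log n := by linarith
                            positivity)
  have hsq : φ ^ 2 ≤ 1 := by nlinarith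
  have h2 : walkLength Φ n * φ ^ 2 ≤ 402 * Real.log n := by
    have := mul_le_mul_of_nonneg_right h1.le (sq_nonneg φ)
    rw [add_mul, div_mul_cancel₀ _ (by positivity)] at this
    linarith
  have h3 : Real.exp (-(φ ^ 2 / 500)) ≤ 1 - φ ^ 2 / 1000 := by
    rw [Real.exp_neg, inv_le_iff_one_le_mul₀ (Real.exp_pos _)]
    have h4 := Real.add_one_le_exp (φ ^ 2 / 500)
    have h5 : (0 : ℝ) ≤ 1 - φ ^ 2 / 1000 := by linarith
    have := mul_le_mul_of_nonneg_left h4 h5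
    nlinarith [sq_nonneg φ]
  calc (1 : ℝ) ≤ Real.exp (walkLength Φ n * -(φ ^ 2 / 500) + Real.log n) :=
        Real.one_le_exp (by linarith)
    _ = Real.exp (-(φ ^ 2 / 500)) ^ walkLength Φ n * n := by
        rw [Real.exp_add, Real.exp_log hn', Real.exp_nat_mul]
    _ ≤ _ := mul_le_mul_of_nonneg_right (pow_le_pow_left₀ (Real.exp_pos _).le h3 _) hn'.le

end Numerics

/-! ### Bounds on walks in graphs -/

section WalkBounds

variable {V : Type*} [Fintype V] {G : SimpleGraph V} (hd : ∀ v, 0 < G.degree v)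

local notation "W" => WeightedGraph.ofGraph G hd

lemma abs_inner_le {f g : V → ℝ} {s s' : ℝ} (hf : ∀ u, |f u| ≤ s) (hg : ∀ u, |g u| ≤ s')
    (hs : 0 ≤ s) (hs' : 0 ≤ s') :
    |WeightedGraph.inner W f g| ≤ (Fintype.card V : ℝ) ^ 2 * (s * s') := by
  have hvol : (W).volume Finset.univ ≤ (Fintype.card V : ℝ) ^ 2 := by
    rw [WeightedGraph.ofGraph_volume]; exact_mod_cast vol_le_sq G _
  calc |WeightedGraph.inner W f g| ≤ ∑ u, |(W).deg u * (f u * g u)| :=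
        Finset.abs_sum_le_sum_abs _ _
    _ ≤ ∑ u, (W).deg u * (s * s') := by
        refine Finset.sum_le_sum fun u _ => ?_
        rw [abs_mul, abs_mul, abs_of_pos ((W).deg_pos u)]
        exact mul_le_mul_of_nonneg_left (mul_le_mul (hf u) (hg u) (abs_nonneg _) hs)
          ((W).deg_pos u).le
    _ = (W).volume Finset.univ * (s * s') := by rw [← Finset.sum_mul]; rfl
    _ ≤ _ := mul_le_mul_of_nonneg_right hvol (mul_nonneg hs hs')

/-- On graphs of large conductance, the lazy walk makes functions of mean zero smaller by a factor
of `n ^ 49`. -/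
lemma abs_lazy_iterate_mul_le {Φ : ℝ} (hn : 2 ≤ Fintype.card V) (hΦ : 0 < Φ) (hΦ1 : Φ ≤ 1)
    (h : Φ ≤ conductance G) {f : V → ℝ} {s : ℝ} (hs : 0 ≤ s) (hf : ∀ u, |f u| ≤ s)
    (hf0 : (W).inner (fun _ => 1) f = 0) (u : V) :
    |(W).lazy^[walkLength Φ (Fintype.card V)] f u| * (Fintype.card V : ℝ) ^ 49 ≤ s := by
  set T := walkLength Φ (Fintype.card V)
  set φ := effectiveBound Φ (Fintype.card V) with hφ_def
  have hφ1 : φ ≤ 1 := effectiveBound_le_one hn hΦ1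
  have hφ : 0 < φ := effectiveBound_pos hn
  have hpoin := (W).sq_mul_inner_self_le_energy hφ (fun S hS => by
    simp only [WeightedGraph.ofGraph_volume, WeightedGraph.ofGraph_cut] at hS ⊢
    exact mul_vol_le_cutSize hn hΦ h S (by exact_mod_cast hS))
  have h1 := (W).inner_lazy_iterate_self_le (γ := φ ^ 2 / 2) (by nlinarith) hpoin T hf0
  have h2 := pow_walkLength_mul_le_one (Φ := Φ) hn hΦ1
  have h3 : (W).inner f f ≤ (Fintype.card V : ℝ) ^ 2 * (s * s) :=
    (le_abs_self _).trans (abs_inner_le hd hf hf hs hs)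
  have h4 := (W).deg_mul_sq_le_inner_self ((W).lazy^[T] f) u
  have h5 : 1 ≤ (W).deg u := by
    rw [WeightedGraph.ofGraph_deg]; exact_mod_cast hd u
  set n : ℝ := (Fintype.card V : ℝ) with hn_def
  set x := (W).lazy^[T] f u
  have hn0 : 0 < n := by
    have : (2 : ℝ) ≤ n := by rw [hn_def]; exact_mod_cast hn
    linarith
  have h6 : x ^ 2 ≤ (1 - φ ^ 2 / 2 / 2) ^ T * (n ^ 2 * (s * s)) := by
    have h7 : (0 : ℝ) ≤ (1 - φ ^ 2 / 2 / 2) ^ T := pow_nonneg (by nlinarith) _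
    have h8 := mul_le_mul_of_nonneg_left h3 h7
    have h9 := mul_le_mul_of_nonneg_right h5 (sq_nonneg x)
    linarith
  apply abs_le_of_sq_le_sq' _ hs |>.2
  rw [mul_pow, sq_abs]
  calc x ^ 2 * (n ^ 49) ^ 2 ≤ (1 - φ ^ 2 / 2 / 2) ^ T * (n ^ 2 * (s * s)) * (n ^ 49) ^ 2 :=
        mul_le_mul_of_nonneg_right h6 (by positivity)
    _ = (1 - φ ^ 2 / 2 / 2) ^ T * n ^ 100 * s ^ 2 := by ring
    _ ≤ 1 * s ^ 2 := mul_le_mul_of_nonneg_right h2 (sq_nonneg s)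
    _ = s ^ 2 := one_mul _

lemma avg_indicator_of_closed {K : Finset V} (hK : ∀ u v, u ∈ K → G.Adj u v → v ∈ K) :
    (W).avg (fun u => if u ∈ K then 1 else 0) = fun u => if u ∈ K then 1 else 0 := by
  ext u
  rw [WeightedGraph.avg, div_eq_iff ((W).deg_pos u).ne', WeightedGraph.deg, Finset.mul_sum]
  refine Finset.sum_congr rfl fun v _ => ?_
  rw [WeightedGraph.ofGraph_w]
  by_cases h : G.Adj u v
  · have : v ∈ K ↔ u ∈ K := ⟨fun hv => hK v u hv h.symm, fun hu => hK u v hu h⟩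
    simp [h, this]
  · simp [h]

end WalkBounds

section Decision

variable {c : ℝ} {V : Type*} [Fintype V] (N : Network c V) (r : V → Fin 3)
  (hd : ∀ v, 0 < N.graph.degree v)

/-- The total mass of the start vector on a set that no edge leaves. -/
lemma inner_indicator_startVector {K : Finset V}
    (hK : ∀ u v, u ∈ K → N.graph.Adj u v → v ∈ K) (T : ℕ) :
    (walkGraph N hd).inner (fun u => if u ∈ K then 1 else 0) (startVector N r hd T) =
      K.card - Fintype.card V * ∑ u ∈ K, leader N T u := by
  have h1 : startVector N r hd T = (fun v => (1 - Fintype.card V * leader N T v)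
      / N.graph.degree v) + ((fun v => (r v : ℝ)) - (walkGraph N hd).avg fun v => (r v : ℝ)) := rfl
  rw [h1, WeightedGraph.inner_add_right, WeightedGraph.inner_sub_right,
    ← (walkGraph N hd).inner_avg_comm, avg_indicator_of_closed hd hK, sub_self, add_zero]
  have h2 : (K.card : ℝ) - Fintype.card V * ∑ u ∈ K, leader N T u =
      ∑ u, if u ∈ K then 1 - Fintype.card V * leader N T u else 0 := by
    rw [Finset.sum_ite_mem, Finset.univ_inter, Finset.sum_sub_distrib, Finset.mul_sum]; simp
  rw [h2, WeightedGraph.inner]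
  refine Finset.sum_congr rfl fun u _ => ?_
  have hd' : (N.graph.degree u : ℝ) ≠ 0 := by exact_mod_cast (hd u).ne'
  rw [WeightedGraph.ofGraph_deg]
  split_ifs
  · field_simp
  · simp

lemma lazy_iterate_indicator_of_closed {K : Finset V}
    (hK : ∀ u v, u ∈ K → N.graph.Adj u v → v ∈ K) (t : ℕ) :
    (walkGraph N hd).lazy^[t] (fun u => if u ∈ K then 1 else 0) =
      fun u => if u ∈ K then 1 else 0 := by
  refine Function.iterate_fixed ?_ t
  ext u
  rw [WeightedGraph.lazy, avg_indicator_of_closed hd hK]; ring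

lemma abs_startVector_le (hn : 2 ≤ Fintype.card V) (T : ℕ) (v : V) :
    |startVector N r hd T v| ≤ 2 * Fintype.card V := by
  have hn' : (2 : ℝ) ≤ Fintype.card V := by exact_mod_cast hn
  have hd' : (1 : ℝ) ≤ N.graph.degree v := by exact_mod_cast hd v
  have h0 : ∀ u, (0 : ℝ) ≤ r u ∧ (r u : ℝ) ≤ 2 := fun u =>
    ⟨Nat.cast_nonneg _, by exact_mod_cast (by omega : (r u : ℕ) ≤ 2)⟩
  have h1 := abs_avg_coin_le N r hd v
  have h1' : 0 ≤ (walkGraph N hd).avg (fun u => (r u : ℝ)) v :=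
    div_nonneg (Finset.sum_nonneg fun u _ => mul_nonneg ((walkGraph N hd).nonneg _ _) (h0 u).1)
      ((walkGraph N hd).deg_pos v).le
  have h2 : |(1 - Fintype.card V * leader N T v) / N.graph.degree v| ≤ (Fintype.card V : ℝ) := by
    rw [abs_div, abs_of_pos (by linarith : (0 : ℝ) < N.graph.degree v),
      div_le_iff₀ (by linarith)]
    have : |1 - Fintype.card V * leader N T v| ≤ (Fintype.card V : ℝ) := by
      rw [leader, abs_le]; split_ifs <;> constructor <;> linarith
    nlinarith
  have h3 : |(r v : ℝ) - (walkGraph N hd).avg (fun u => (r u : ℝ)) v| ≤ 2 := by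
    have := h0 v
    have := (abs_le.1 h1).2
    rw [abs_le]; constructor <;> linarith
  have := abs_add_le ((1 - Fintype.card V * leader N T v) / N.graph.degree v)
    ((r v : ℝ) - (walkGraph N hd).avg (fun u => (r u : ℝ)) v)
  rw [startVector]
  linarith

/-! ### Graphs of large conductance are accepted -/

/-- An identifier has spread at least as far as the mass of its vertex. -/
lemma id_le_maxId_of_lazy_ne_zero (u : V) (t : ℕ) (v : V)
    (h : (walkGraph N hd).lazy^[t] (fun x => if x ∈ ({u} : Finset V) then 1 else 0) v ≠ 0) :
    N.id u ≤ maxId N t v := by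
  induction t generalizing v with
  | zero =>
    have : v = u := by simpa using h
    rw [this]; exact le_rfl
  | succ t ih =>
    rw [Function.iterate_succ_apply', WeightedGraph.lazy] at h
    rw [maxId]
    by_contra! hlt
    rw [max_lt_iff] at hlt
    obtain ⟨h1, h2⟩ := hlt
    have hv : (walkGraph N hd).lazy^[t] (fun x => if x ∈ ({u} : Finset V) then 1 else 0) v = 0 := by
      by_contra h'; exact absurd (ih v h') (not_le.2 h1)
    refine h ?_
    rw [hv, WeightedGraph.avg, Finset.sum_eq_zero, zero_div, zero_add, zero_div]
    intro x _
    rw [WeightedGraph.ofGraph_w]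
    split_ifs with hadj
    · have hx : (walkGraph N hd).lazy^[t] (fun x => if x ∈ ({u} : Finset V) then 1 else 0) x
          = 0 := by
        by_contra h'
        have h3 := ih x h'
        have h4 := Finset.le_sup (f := fun i => maxId N t (N.neighbor v i))
          (Finset.mem_univ ((N.port v).symm ⟨x, hadj⟩))
        simp only [Network.neighbor, Equiv.apply_symm_apply] at h4
        exact absurd (h3.trans h4) (not_le.2 h2)
      rw [hx, mul_zero]
    · rw [zero_mul]

variable {Φ : ℝ} (hn : 2 ≤ Fintype.card V) (hΦ : 0 < Φ) (hΦ1 : Φ ≤ 1)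

include hd hn hΦ hΦ1 in
lemma id_le_maxId_of_conductance (h : Φ ≤ conductance N.graph) (u v : V) :
    N.id u ≤ maxId N (walkLength Φ (Fintype.card V)) v := by
  apply id_le_maxId_of_lazy_ne_zero N hd
  set W := walkGraph N hd with hW
  set T := walkLength Φ (Fintype.card V)
  set n : ℝ := (Fintype.card V : ℝ) with hn_def
  have hn2 : (2 : ℝ) ≤ n := by rw [hn_def]; exact_mod_cast hn
  have hvolu : 1 ≤ W.volume {u} := by
    rw [WeightedGraph.ofGraph_volume]
    have : 1 ≤ vol N.graph {u} := by
      rw [vol, Finset.sum_singleton]; exact hd u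
    exact_mod_cast this
  have hvol : W.volume Finset.univ ≤ n ^ 2 := by
    rw [WeightedGraph.ofGraph_volume, hn_def]; exact_mod_cast vol_le_sq N.graph _
  have hvolpos : 0 < W.volume Finset.univ :=
    (zero_lt_one.trans_le hvolu).trans_le (W.volume_mono (Finset.subset_univ _))
  have h1 := abs_lazy_iterate_mul_le hd hn hΦ hΦ1 h zero_le_one
    (W.abs_centeredIndicator_le {u}) (W.inner_one_centeredIndicator (by linarith)) v
  have h2 : W.centeredIndicator {u} = (fun x => if x ∈ ({u} : Finset V) then 1 else 0)
      - fun _ => W.volume {u} / W.volume Finset.univ := rfl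
  rw [h2, WeightedGraph.lazy_iterate_sub, WeightedGraph.lazy_iterate_const] at h1
  intro h0
  rw [Pi.sub_apply, h0, zero_sub, abs_neg, abs_of_pos (by positivity), div_mul_eq_mul_div,
    div_le_one hvolpos] at h1
  have h3 : n ^ 2 < n ^ 49 := pow_lt_pow_right₀ (by linarith) (by norm_num)
  have h4 : 0 < n ^ 49 := by positivity
  nlinarith

include hd hn hΦ hΦ1 in
lemma sum_leader_of_conductance (h : Φ ≤ conductance N.graph) :
    ∑ u, leader N (walkLength Φ (Fintype.card V)) u = 1 := by
  have hne : Nonempty V := Fintype.card_pos_iff.1 (by omega)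
  obtain ⟨x, -, hx⟩ := Finset.exists_max_image Finset.univ N.id Finset.univ_nonempty
  have h1 : ∀ v, maxId N (walkLength Φ (Fintype.card V)) v = N.id x := fun v =>
    le_antisymm (maxId_le_of_closed N (K := Set.univ) (fun _ _ _ _ => trivial)
      (fun v _ => hx v (Finset.mem_univ v)) _ v trivial)
      (id_le_maxId_of_conductance N hd hn hΦ hΦ1 h x v)
  simp [leader, h1, N.id_injective.eq_iff]

include hd hn hΦ hΦ1 in
/-- Completeness: the total mass of the start vector vanishes, hence the walk converges to `0`. -/
lemma walkVerdict_of_conductance (h : Φ ≤ conductance N.graph) (v : V) :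
    walkVerdict (Fintype.card V) (trajectory N (walkLength Φ) r
      (walkLength Φ (Fintype.card V) + 1 + walkLength Φ (Fintype.card V)) v) = true := by
  set T := walkLength Φ (Fintype.card V) with hT
  have hF : (walkGraph N hd).inner (fun _ => 1) (startVector N r hd T) = 0 := by
    have := inner_indicator_startVector N r hd (K := Finset.univ) (by simp) T
    simp only [Finset.mem_univ, if_true] at this
    rw [this, sum_leader_of_conductance N hd hn hΦ hΦ1 h, Finset.card_univ]
    ring
  have h1 := abs_lazy_iterate_mul_le hd hn hΦ hΦ1 h (by positivity)
    (abs_startVector_le N r hd hn T) hF v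
  have h2 := abs_trajectory_value_sub_le N (walkLength Φ) r hd hn T v
  have h3 := walkLength_add_one_le (Φ := Φ) hn
  rw [← hT] at h1 h2 h3
  set n : ℝ := (Fintype.card V : ℝ) with hn_def
  have hn2 : (2 : ℝ) ≤ n := by rw [hn_def]; exact_mod_cast hn
  have hscale : (scale (Fintype.card V) : ℝ) = n ^ 40 := by simp [scale, hn_def]
  have htol : (tolerance (Fintype.card V) : ℝ) = n ^ 20 := by simp [tolerance, hn_def]
  rw [hscale] at h2
  set x := (walkGraph N hd).lazy^[T] (startVector N r hd T) v
  have h4 : |n ^ 40 * x| ≤ n ^ 16 := by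
    rw [abs_mul, abs_of_nonneg (by positivity)]
    have h5 : 2 * n ≤ n ^ 9 * n ^ 16 := by
      calc 2 * n ≤ n * n := by nlinarith
        _ = n ^ 2 := by ring
        _ ≤ n ^ 25 := pow_le_pow_right₀ (by linarith) (by norm_num)
        _ = _ := by ring
    have h6 : n ^ 9 * (n ^ 40 * |x|) ≤ n ^ 9 * n ^ 16 := by
      calc n ^ 9 * (n ^ 40 * |x|) = |x| * n ^ 49 := by ring
        _ ≤ _ := h1.trans h5
    exact le_of_mul_le_mul_left h6 (by positivity)
  have h7 : 2 * n ^ 16 ≤ n ^ 20 := by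
    calc 2 * n ^ 16 ≤ n * n ^ 16 := mul_le_mul_of_nonneg_right hn2 (by positivity)
      _ = n ^ 17 := by ring
      _ ≤ _ := pow_le_pow_right₀ (by linarith) (by norm_num)
  rw [walkVerdict, decide_eq_true_iff]
  rw [abs_le] at h2 h4
  constructor
  · rw [← Nat.cast_le (α := ℝ), Nat.cast_add, htol]; linarith
  · rw [← Nat.cast_le (α := ℝ), Nat.cast_add, htol]; linarith

/-! ### Graphs of small conductance are rejected -/

include hd hn in
/-- If all vertices accept, then the walk ends close to `0`. -/
lemma abs_lazy_iterate_le_of_walkVerdict (hacc : ∀ v, walkVerdict (Fintype.card V)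
      (trajectory N (walkLength Φ) r
        (walkLength Φ (Fintype.card V) + 1 + walkLength Φ (Fintype.card V)) v) = true) (v : V) :
    |(walkGraph N hd).lazy^[walkLength Φ (Fintype.card V)]
      (startVector N r hd (walkLength Φ (Fintype.card V))) v| * (Fintype.card V : ℝ) ^ 19 ≤ 1 := by
  have h2 := abs_trajectory_value_sub_le N (walkLength Φ) r hd hn
    (walkLength Φ (Fintype.card V)) v
  have h3 := walkLength_add_one_le (Φ := Φ) hn
  have h4 := hacc v
  set T := walkLength Φ (Fintype.card V) with hT
  set n : ℝ := (Fintype.card V : ℝ) with hn_def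
  have hn2 : (2 : ℝ) ≤ n := by rw [hn_def]; exact_mod_cast hn
  have hscale : (scale (Fintype.card V) : ℝ) = n ^ 40 := by simp [scale, hn_def]
  have htol : (tolerance (Fintype.card V) : ℝ) = n ^ 20 := by simp [tolerance, hn_def]
  rw [hscale] at h2
  rw [walkVerdict, decide_eq_true_iff, ← Nat.cast_le (α := ℝ), ← Nat.cast_le (α := ℝ),
    Nat.cast_add, Nat.cast_add, htol] at h4
  set x := (walkGraph N hd).lazy^[T] (startVector N r hd T) v
  have h5 : n ^ 16 ≤ n ^ 20 := pow_le_pow_right₀ (by linarith) (by norm_num)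
  have h6 : 2 * n ^ 20 ≤ n * n ^ 20 := mul_le_mul_of_nonneg_right hn2 (by positivity)
  have h7 : |n ^ 40 * x| ≤ n * n ^ 20 := by
    rw [abs_le] at h2 ⊢
    constructor <;> linarith
  rw [abs_mul, abs_of_nonneg (by positivity)] at h7
  have h8 : n ^ 21 * (|x| * n ^ 19) ≤ n ^ 21 * 1 := by
    calc n ^ 21 * (|x| * n ^ 19) = n ^ 40 * |x| := by ring
      _ ≤ _ := h7
      _ = _ := by ring
  exact le_of_mul_le_mul_left h8 (by positivity)

include hd hn in
/-- If all vertices accept, then the final state of the walk is almost orthogonal to every bounded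
function. -/
lemma abs_inner_mul_le_of_walkVerdict (hacc : ∀ v, walkVerdict (Fintype.card V)
      (trajectory N (walkLength Φ) r
        (walkLength Φ (Fintype.card V) + 1 + walkLength Φ (Fintype.card V)) v) = true)
    {g : V → ℝ} (hg : ∀ v, |g v| ≤ 1) :
    |(walkGraph N hd).inner ((walkGraph N hd).lazy^[walkLength Φ (Fintype.card V)] g)
      (startVector N r hd (walkLength Φ (Fintype.card V)))| * (Fintype.card V : ℝ) ^ 17 ≤ 1 := by
  have h1 := abs_lazy_iterate_le_of_walkVerdict N r hd hn hacc
  set n : ℝ := (Fintype.card V : ℝ) with hn_def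
  have hn2 : (2 : ℝ) ≤ n := by rw [hn_def]; exact_mod_cast hn
  have h2 := abs_inner_le hd hg (fun v => (le_div_iff₀ (by positivity)).2 (h1 v)) zero_le_one
    (by positivity)
  rw [← WeightedGraph.inner_lazy_iterate_comm, ← hn_def] at h2
  calc _ ≤ n ^ 2 * (1 * (1 / n ^ 19)) * n ^ 17 :=
        mul_le_mul_of_nonneg_right h2 (by positivity)
    _ = 1 := by field_simp

include hd hn in
/-- On a disconnected graph, every connected component contains a leader but fewer than `n`
vertices, so that its total mass is negative. -/
lemma connected_of_walkVerdict (hacc : ∀ v, walkVerdict (Fintype.card V)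
      (trajectory N (walkLength Φ) r
        (walkLength Φ (Fintype.card V) + 1 + walkLength Φ (Fintype.card V)) v) = true) :
    N.graph.Connected := by
  have hne : Nonempty V := Fintype.card_pos_iff.1 (by omega)
  refine ⟨fun x y => ?_⟩
  by_contra hxy
  set K : Finset V := Finset.univ.filter fun v => N.graph.Reachable x v with hK_def
  have hmem : ∀ v, v ∈ K ↔ N.graph.Reachable x v := by simp [hK_def]
  have hK : ∀ u v, u ∈ K → N.graph.Adj u v → v ∈ K := fun u v hu huv =>
    (hmem v).2 (((hmem u).1 hu).trans huv.reachable)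
  have hcard : K.card + 1 ≤ Fintype.card V := by
    rw [← Finset.card_univ]
    exact Finset.card_lt_card
      (Finset.ssubset_univ_iff.2 fun h => hxy ((hmem y).1 (h ▸ Finset.mem_univ y)))
  have h1 := abs_inner_mul_le_of_walkVerdict N r hd hn hacc
    (g := fun u => if u ∈ K then 1 else 0) (fun u => by split_ifs <;> simp)
  rw [lazy_iterate_indicator_of_closed N hd hK, inner_indicator_startVector N r hd hK] at h1
  have h2 : 1 ≤ ∑ u ∈ K, leader N (walkLength Φ (Fintype.card V)) u := by
    obtain ⟨z, hz, hmax⟩ := Finset.exists_max_image K N.id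
      ⟨x, (hmem x).2 (SimpleGraph.Reachable.refl x)⟩
    have h3 : leader N (walkLength Φ (Fintype.card V)) z = 1 :=
      if_pos (le_antisymm (maxId_le_of_closed N (K := {v | v ∈ K}) hK hmax _ z hz)
        (id_le_maxId N _ z))
    rw [← h3]
    exact Finset.single_le_sum (fun u _ => by rw [leader]; split_ifs <;> norm_num) hz
  have h4 : (K.card : ℝ) + 1 ≤ Fintype.card V := by exact_mod_cast hcard
  set n : ℝ := (Fintype.card V : ℝ) with hn_def
  have hn2 : (2 : ℝ) ≤ n := by rw [hn_def]; exact_mod_cast hn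
  have h5 : 1 ≤ |(K.card : ℝ) - n * ∑ u ∈ K, leader N (walkLength Φ (Fintype.card V)) u| := by
    rw [abs_sub_comm]
    refine le_trans ?_ (le_abs_self _)
    nlinarith
  have h6 : 1 < n ^ 17 := one_lt_pow₀ (by linarith) (by norm_num)
  nlinarith

include hd hn hΦ1 in
/-- Soundness on connected graphs: at some vertex `v`, changing the random number changes the
component of the walk along a sparse cut so much that the vertices do not accept both before and
after the change. -/
lemma exists_eq_of_walkVerdict (hG : N.graph.Connected)
    (h : conductance N.graph < effectiveBound Φ (Fintype.card V) ^ 2 / 1000) :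
    ∃ v, ∀ r r' : V → Fin 3,
      (∀ v, walkVerdict (Fintype.card V) (trajectory N (walkLength Φ) r
        (walkLength Φ (Fintype.card V) + 1 + walkLength Φ (Fintype.card V)) v) = true) →
      (∀ v, walkVerdict (Fintype.card V) (trajectory N (walkLength Φ) r'
        (walkLength Φ (Fintype.card V) + 1 + walkLength Φ (Fintype.card V)) v) = true) →
      (∀ u ≠ v, r u = r' u) → r v = r' v := by
  obtain ⟨S, hS, hle, hcut⟩ := exists_sparse_cut hn hd h
  set W := walkGraph N hd with hW
  set T := walkLength Φ (Fintype.card V) with hT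
  set φ := effectiveBound Φ (Fintype.card V) with hφ
  have hφ1 : φ ≤ 1 := effectiveBound_le_one hn hΦ1
  have hφ0 : 0 < φ := effectiveBound_pos hn
  have hS' : 1 ≤ W.volume S := by rw [WeightedGraph.ofGraph_volume]; exact_mod_cast hS
  have h1 := W.le_inner_lazy_iterate_centeredIndicator (S := S) (δ := φ ^ 2 / 1000)
    (by nlinarith) hS'
    (by simp only [hW, WeightedGraph.ofGraph_volume]; exact_mod_cast hle)
    (by simpa only [hW, WeightedGraph.ofGraph_volume, WeightedGraph.ofGraph_cut] using hcut) T
  have h2 := one_le_pow_walkLength_mul (Φ := Φ) hn hΦ1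
  have hmean : W.inner (fun _ => 1) (W.lazy^[T] (W.centeredIndicator S)) = 0 := by
    rw [W.inner_one_lazy_iterate, W.inner_one_centeredIndicator (by linarith)]
  obtain ⟨v, hv⟩ := exists_abs_le_mul_abs_sub_avg hd hG hmean
  refine ⟨v, fun r r' hr hr' heq => ?_⟩
  by_contra hne
  have a1 := abs_inner_mul_le_of_walkVerdict N r hd hn hr (W.abs_centeredIndicator_le S)
  have a2 := abs_inner_mul_le_of_walkVerdict N r' hd hn hr' (W.abs_centeredIndicator_le S)
  rw [← hT, ← hφ] at h2
  rw [← hT, ← hW] at a1 a2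
  change ∀ u, |W.lazy^[T] (W.centeredIndicator S) u| ≤ 2 * (Fintype.card V : ℝ) ^ 3 *
    (W.deg v * |W.lazy^[T] (W.centeredIndicator S) v
      - W.avg (W.lazy^[T] (W.centeredIndicator S)) v|) at hv
  set k := W.lazy^[T] (W.centeredIndicator S) with hk
  have hdiff : W.inner k (startVector N r hd T) - W.inner k (startVector N r' hd T) =
      W.deg v * (k v - W.avg k v) * ((r v : ℝ) - r' v) := by
    have e : startVector N r hd T - startVector N r' hd T =
        ((fun u => (r u : ℝ)) - (fun u => (r' u : ℝ)))
          - W.avg ((fun u => (r u : ℝ)) - (fun u => (r' u : ℝ))) := by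
      have e' : W.avg ((fun u => (r u : ℝ)) - (fun u => (r' u : ℝ))) =
          W.avg (fun u => (r u : ℝ)) - W.avg (fun u => (r' u : ℝ)) := by
        rw [sub_eq_add_neg, ← neg_one_smul ℝ, W.avg_add, W.avg_smul]; module
      rw [e']
      ext u
      simp only [startVector, Pi.sub_apply, hW]
      ring
    rw [← W.inner_sub_right, e, W.inner_sub_right, ← W.inner_avg_comm, ← W.inner_sub_left,
      WeightedGraph.inner, Finset.sum_eq_single v]
    · simp only [Pi.sub_apply]; ring
    · intro u _ hu
      simp [heq u hu]
    · simp
  have hone : 1 ≤ |(r v : ℝ) - r' v| := by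
    have hne' : ((r v : ℕ) : ℤ) - ((r' v : ℕ) : ℤ) ≠ 0 := by
      rw [sub_ne_zero]
      exact fun h => hne (Fin.ext (by exact_mod_cast h))
    have := Int.one_le_abs hne'
    exact_mod_cast this
  set n : ℝ := (Fintype.card V : ℝ) with hn_def
  have hn2 : (2 : ℝ) ≤ n := by rw [hn_def]; exact_mod_cast hn
  set y := W.deg v * |k v - W.avg k v| with hy
  have hy0 : 0 ≤ y := mul_nonneg (W.deg_pos v).le (abs_nonneg _)
  have h3 : y * n ^ 17 ≤ 2 := by
    have h4 : y ≤ |W.inner k (startVector N r hd T) - W.inner k (startVector N r' hd T)| := by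
      rw [hdiff, abs_mul, abs_mul, abs_of_pos (W.deg_pos v)]
      exact le_mul_of_one_le_right hy0 hone
    have h5 := h4.trans (abs_sub _ _)
    have := mul_le_mul_of_nonneg_right h5 (by positivity : 0 ≤ n ^ 17)
    linarith
  have h6 : y ≤ 2 / n ^ 17 := (le_div_iff₀ (by positivity)).2 h3
  have h7 : ∀ u, |k u| ≤ 4 / n ^ 14 := fun u => (hv u).trans <| by
    calc 2 * n ^ 3 * y ≤ 2 * n ^ 3 * (2 / n ^ 17) :=
          mul_le_mul_of_nonneg_left h6 (by positivity)
      _ = _ := by field_simp; ring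
  have h8 := (le_abs_self _).trans
    (abs_inner_le hd h7 h7 (by positivity) (by positivity))
  have h9 := h1.trans h8
  have h10 : (1 : ℝ) ≤ ((1 - φ ^ 2 / 1000) ^ T) ^ 2 * n ^ 2 := by
    rw [← mul_pow]; exact one_le_pow₀ h2
  have h11 : ((1 - φ ^ 2 / 1000) ^ T) ^ 2 * n ^ 2 ≤ 32 / n ^ 24 := by
    have := mul_le_mul_of_nonneg_right h9 (by positivity : 0 ≤ 2 * n ^ 2)
    calc _ = ((1 - φ ^ 2 / 1000) ^ T) ^ 2 / 2 * (2 * n ^ 2) := by ring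
      _ ≤ _ := this
      _ = _ := by rw [← hn_def]; field_simp; ring
  have h12 : (32 : ℝ) < n ^ 24 := by
    calc (32 : ℝ) < 2 ^ 24 := by norm_num
      _ ≤ _ := pow_le_pow_left₀ two_pos.le hn2 24
  have h13 := (div_lt_one (by positivity : 0 < n ^ 24)).2 h12
  linarith

end Decision

/-! ### The two algorithms -/

/-- The tester for small `ε`: the walk protocol, every number being sent in `numDigits c` digits. -/
def walkTester (c Φ : ℝ) : DistAlgorithm :=
  (walkProtocol (walkLength Φ)).simulation (PMF.uniformOfFintype (Fin 3)) walkStart (numDigits c)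
    (fun n => 2 * walkLength Φ n + 1) walkVerdict

/-- The tester for large `ε`: exactly the isolated vertices reject, without communication. -/
def degreeTester : DistAlgorithm where
  State := Bool
  init _ _ d := PMF.pure (decide (0 < d))
  send _ _ _ := []
  step _ s _ := PMF.pure s
  output s := some s

section

variable {c : ℝ} {V : Type*} [Fintype V] (N : Network c V)

/-- The states in which the vertices start and terminate in `degreeTester`. -/
def degreeOutcome (v : V) : degreeTester.State := decide (0 < N.graph.degree v)

lemma degreeTester_output (v : V) :
    degreeTester.output (degreeOutcome N v) = some (decide (0 < N.graph.degree v)) := rfl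

lemma degreeTester_run (t : ℕ) : degreeTester.run N t = PMF.pure (degreeOutcome N) := by
  induction t with
  | zero => exact piPMF_pure (degreeOutcome N)
  | succ t ih =>
    rw [DistAlgorithm.run, ih, PMF.pure_bind]
    exact (congrArg piPMF (funext fun v => if_pos rfl)).trans (piPMF_pure _)

lemma degreeTester_testsWithin (hc : 1 ≤ c) (hn : 2 ≤ Fintype.card V) {Φ δ ε : ℝ} (hΦ : 0 < Φ)
    (hδ : δ ≤ 1) (hε : 3 < ε) (t : ℕ) :
    degreeTester.TestsWithin N (fun G => Φ ≤ conductance G) (fun G => δ ≤ conductance G) ε t where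
  bandwidth t σ _ v i := by
    have : 0 ≤ Real.logb 2 (Fintype.card V) :=
      Real.logb_nonneg one_lt_two (by exact_mod_cast (by omega : 1 ≤ Fintype.card V))
    have e : degreeTester.message N σ v i = [] := if_pos rfl
    rw [e]
    simpa using mul_nonneg (by linarith) this
  halts _ _ _ := rfl
  complete h := by
    rw [DistAlgorithm.probAccept, degreeTester_run, PMF.toOuterMeasure_pure_apply, if_pos]
    · exact ENNReal.div_le_of_le_mul (by norm_num)
    · intro v
      rw [degreeTester_output, decide_eq_true (degree_pos_of_conductance_pos hn (hΦ.trans_le h) v)]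
  sound h := by
    rw [DistAlgorithm.probReject, degreeTester_run, PMF.toOuterMeasure_pure_apply, if_pos]
    · exact ENNReal.div_le_of_le_mul (by norm_num)
    · by_contra hall
      refine absurd (le_three_of_isFar hn (fun v => ?_) hδ h) (not_le.2 hε)
      by_contra hv
      exact hall ⟨v, by rw [degreeTester_output, decide_eq_false hv]⟩

/-- The states of the vertices after `t` rounds for given random choices. -/
def walkTrace (Φ : ℝ) (t : ℕ) (r : V → Fin 3) : V → (walkTester c Φ).State :=
  (walkProtocol (walkLength Φ)).trace (PMF.uniformOfFintype (Fin 3)) walkStart (numDigits c)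
    (fun n => 2 * walkLength Φ n + 1) walkVerdict N t r

variable {Φ : ℝ}

lemma walkTester_run (hn : 2 ≤ Fintype.card V) (t : ℕ) : (walkTester c Φ).run N t =
    (PMF.uniformOfFintype (V → Fin 3)).map (walkTrace N Φ t) := by
  rw [← piPMF_uniform]
  exact (walkProtocol (walkLength Φ)).simulation_run _ _ _ _ _ N (by simp [numDigits])
    (fun r j v _ => msg_lt N (walkLength Φ) r hn j v) t

lemma walkTester_output {t : ℕ} (ht : numDigits c * (2 * walkLength Φ (Fintype.card V) + 1) ≤ t)
    (r : V → Fin 3) (v : V) :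
    (walkTester c Φ).output (walkTrace N Φ t r v) =
      some (walkVerdict (Fintype.card V) (trajectory N (walkLength Φ) r
        (walkLength Φ (Fintype.card V) + 1 + walkLength Φ (Fintype.card V)) v)) := by
  have e : walkLength Φ (Fintype.card V) + 1 + walkLength Φ (Fintype.card V) =
      2 * walkLength Φ (Fintype.card V) + 1 := by ring
  rw [e]
  exact (walkProtocol (walkLength Φ)).simulation_output _ _ _ _ _ N (by simp [numDigits]) ht r v

lemma walkTester_testsWithin (hn : 2 ≤ Fintype.card V) (hc : 1 ≤ c) {ε : ℝ} (hΦ : 0 < Φ)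
    (hΦ1 : Φ ≤ 1) (hε : 0 < ε) {t : ℕ}
    (ht : numDigits c * (2 * walkLength Φ (Fintype.card V) + 1) ≤ t) :
    (walkTester c Φ).TestsWithin N (fun G => Φ ≤ conductance G)
      (fun G => Φ ^ 2 / 1000 ≤ conductance G) ε t where
  bandwidth := (walkProtocol (walkLength Φ)).simulation_respectsBandwidth _ _ _ _ _ N hc hn
    (by simp [numDigits]) (fun r j v _ => msg_lt N (walkLength Φ) r hn j v)
  halts σ hσ v := by
    rw [walkTester_run N hn, PMF.mem_support_map_iff] at hσ
    obtain ⟨r, -, rfl⟩ := hσ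
    rw [walkTester_output N ht]
    rfl
  complete h := by
    rw [DistAlgorithm.probAccept, walkTester_run N hn, PMF.toOuterMeasure_map_apply]
    have hd := degree_pos_of_conductance_pos hn (hΦ.trans_le h)
    have v : V := (Fintype.card_pos_iff.1 (by omega)).some
    refine two_thirds_le_uniform _ v fun r hr => absurd ?_ hr
    intro v
    rw [walkTester_output N ht, walkVerdict_of_conductance N r hd hn hΦ hΦ1 h]
  sound h := by
    rw [DistAlgorithm.probReject, walkTester_run N hn, PMF.toOuterMeasure_map_apply]
    have hnot : ∀ r ∉ walkTrace N Φ t ⁻¹' {σ | ∃ v, (walkTester c Φ).output (σ v) = some false}, ∀ v,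
        walkVerdict (Fintype.card V) (trajectory N (walkLength Φ) r
          (walkLength Φ (Fintype.card V) + 1 + walkLength Φ (Fintype.card V)) v) = true := by
      intro r hr v
      by_contra hv
      refine hr ⟨v, ?_⟩
      rw [walkTester_output N ht, (Bool.not_eq_true _).mp hv]
    by_cases hd : ∀ v, 0 < N.graph.degree v
    · by_cases hG : N.graph.Connected
      · have hlt := conductance_lt_of_isFar hn hd hε h
        have hle : Φ ^ 2 / 1000 ≤ effectiveBound Φ (Fintype.card V) ^ 2 / 1000 :=
          div_le_div_of_nonneg_right (pow_le_pow_left₀ hΦ.le (le_max_left _ _) 2) (by norm_num)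
        obtain ⟨v, hv⟩ := exists_eq_of_walkVerdict N hd hn hΦ1 hG (hlt.trans_le hle)
        exact two_thirds_le_uniform _ v fun r hr r' hr' => hv r r' (hnot r hr) (hnot r' hr')
      · have v : V := (Fintype.card_pos_iff.1 (by omega)).some
        exact two_thirds_le_uniform _ v fun r hr =>
          absurd (connected_of_walkVerdict N r hd hn (hnot r hr)) hG
    · push Not at hd
      obtain ⟨v, hv⟩ := hd
      refine two_thirds_le_uniform _ v fun r hr => absurd (hnot r hr v) ?_
      rw [walkVerdict, trajectory_value_of_degree_eq_zero N _ r (Nat.le_zero.1 hv),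
        decide_eq_true_iff]
      rintro ⟨h1, -⟩
      -- The value `0` is far from `origin n = 2 * n ^ 41`.
      rw [origin, tolerance, scale, zero_add] at h1
      have h2 : Fintype.card V ^ 20 ≤ Fintype.card V ^ 40 :=
        Nat.pow_le_pow_right (by omega) (by norm_num)
      have h3 : 0 < Fintype.card V ^ 40 := by positivity
      nlinarith

end

end CongestTesting

end

open CongestTesting
theorem theorem1 (c : ℝ) (hc : 1 ≤ c) :
    ∃ C : ℝ, 0 < C ∧
      ∀ Φ ε : ℝ, 0 < Φ → Φ ≤ 1 → 0 < ε →
        ∃ A : DistAlgorithm,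
          ∀ (V : Type*) [Fintype V] (N : Network c V), 2 ≤ Fintype.card V →
            A.TestsWithin N
              (fun G => Φ ≤ conductance G)
              (fun G => Φ ^ 2 / 1000 ≤ conductance G)
              ε
              ⌊C * Real.log ((Fintype.card V : ℝ) + (numEdges N.graph : ℝ)) / (ε * Φ ^ 2)⌋₊ := by
  have hk : (0 : ℝ) < numDigits c := by exact_mod_cast (by simp [numDigits] : 0 < numDigits c)
  refine ⟨2418 * numDigits c, by positivity, fun Φ ε hΦ hΦ1 hε => ?_⟩
  -- For `ε > 3` the time bound may be less than one round.
  rcases lt_or_ge 3 ε with h3 | h3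
  · exact ⟨degreeTester, fun V _ N hn =>
      degreeTester_testsWithin N hc hn hΦ (by nlinarith) h3 _⟩
  · refine ⟨walkTester c Φ, fun V _ N hn => walkTester_testsWithin N hn hc hΦ hΦ1 hε ?_⟩
    apply Nat.le_floor
    push_cast
    have h1 := walkLength_le_mul_log (Φ := Φ) hn hΦ hΦ1
    have hn' : (0 : ℝ) < Fintype.card V := by exact_mod_cast (by omega : 0 < Fintype.card V)
    have h2 : Real.log (Fintype.card V) ≤
        Real.log ((Fintype.card V : ℝ) + (numEdges N.graph : ℝ)) :=
      Real.log_le_log hn' (le_add_of_nonneg_right (Nat.cast_nonneg _))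
    have h4 := one_le_two_mul_log hn
    calc (numDigits c : ℝ) * (2 * walkLength Φ (Fintype.card V) + 1)
        ≤ numDigits c * (806 * Real.log (Fintype.card V) / Φ ^ 2) :=
          mul_le_mul_of_nonneg_left h1 hk.le
      _ = 2418 * numDigits c * Real.log (Fintype.card V) / (3 * Φ ^ 2) := by ring
      _ ≤ 2418 * numDigits c * Real.log ((Fintype.card V : ℝ) + (numEdges N.graph : ℝ))
          / (3 * Φ ^ 2) :=
        div_le_div_of_nonneg_right (mul_le_mul_of_nonneg_left h2 (by positivity)) (by positivity)
      _ ≤ _ := div_le_div_of_nonneg_left (mul_nonneg (by positivity) (by linarith))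
          (by positivity) (mul_le_mul_of_nonneg_right h3 (by positivity))
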